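/- Let $\Gamma$ be a finite compact connected metric graph with $N$ edges, $E_n$ being an interval of length $\ell_n\in(0,\infty)$, whose endpoints are joined together in $M$ vertices (each vertex is a non-empty class of endpoints; loops and multiple edges are allowed). Let some (possibly empty) set of vertices of degree one be marked as Dirichlet vertices; all other vertices are called standard. Let $L=-\frac{d^2}{dx^2}$ act in $L_2(\Gamma)=\bigoplus_n L_2(E_n)$ on the functions $u\in W_2^2(\Gamma)=\bigoplus_n W_2^2(E_n)$ that vanish at every Dirichlet vertex and that at every standard vertex are continuous and have vanishing sum of the derivatives at the endpoints belonging to the vertex, taken in the directions pointing inside the edges. Assume that $\Gamma$ is a tree (connected without cycles; Dirichlet vertices allowed) or that the set of Dirichlet vertices is non-empty. Let $\chi=M-N$ be the Euler characteristic, where $M$ counts all vertices including the Dirichlet ones. If $\chi$ is even, then there is an infinite (strictly increasing) sequence of simple eigenvalues of $L$ whose eigenfunctions have an even number of nodal domains; if $\chi$ is odd, then there is an infinite (strictly increasing) sequence of simple eigenvalues of $L$ whose eigenfunctions have an odd number of nodal domains. Here the nodal domains of an eigenfunction $\psi$ are the connected components of $\{x\in\Gamma:\psi(x)\neq 0\}$,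 and their number is finite. -/

import Mathlib

open Set MeasureTheory

noncomputable section

/-- A finite compact metric graph (loops and multiple edges allowed): every edge `e` is a copy of
the interval `[0, ℓ e]` with `0 < ℓ e`, whose left and right endpoints (`false` and `true`) are
attached to vertices. Vertices are classes of endpoints, so each of them contains at least one
endpoint. The distinguished Dirichlet vertices have degree one; all others are standard. -/
structure MetricGraph (V E : Type*) where
  /-- the vertex to which an endpoint of an edge belongs -/
  ends : E → Bool → V
  /-- the length of an edge -/
  length : E → ℝ
  length_pos : ∀ e, 0 < length e
  ends_surjective : ∀ v, ∃ e b, ends e b = v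
  /-- the set of Dirichlet vertices -/
  dirichlet : Set V
  degree_dirichlet : ∀ v ∈ dirichlet, {p : E × Bool | ends p.1 p.2 = v}.ncard = 1

namespace MetricGraph

variable {V E : Type*} (Γ : MetricGraph V E)

/-! ### Discrete structure -/

/-- Two distinct vertices are adjacent iff some edge joins them. -/
def graph : SimpleGraph V :=
  SimpleGraph.fromRel fun v w => ∃ e, Γ.ends e false = v ∧ Γ.ends e true = w

/-- The graph is a tree: no loops, no two edges joining the same pair of vertices, and the
resulting simple graph is connected and has no cycle. -/
def IsTree : Prop :=
  (∀ e, Γ.ends e false ≠ Γ.ends e true) ∧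
    Function.Injective (fun e => s(Γ.ends e false, Γ.ends e true)) ∧ Γ.graph.IsTree

/-- Euler characteristic: number of vertices (Dirichlet ones included) minus number of edges. -/
def eulerChar [Fintype V] [Fintype E] (_Γ : MetricGraph V E) : ℤ :=
  (Fintype.card V : ℤ) - Fintype.card E

/-! ### The metric graph as a topological space -/

/-- The edge `e` as a closed interval. -/
abbrev Edge (e : E) : Type := Icc (0 : ℝ) (Γ.length e)

/-- The left (`false`) and right (`true`) endpoint of an edge. -/
def endpoint (e : E) (b : Bool) : Γ.Edge e :=
  if b then ⟨Γ.length e, (Γ.length_pos e).le, le_rfl⟩ else ⟨0, le_rfl, (Γ.length_pos e).le⟩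

/-- Endpoints belonging to the same vertex are to be identified. -/
def Glue (p q : Σ e, Γ.Edge e) : Prop :=
  ∃ e b e' b', p = ⟨e, Γ.endpoint e b⟩ ∧ q = ⟨e', Γ.endpoint e' b'⟩ ∧ Γ.ends e b = Γ.ends e' b'

/-- The topological space underlying the metric graph: the disjoint union of the edges with the
endpoints at each vertex identified, with the quotient topology. -/
abbrev Space : Type _ := Quot Γ.Glue

/-! ### The Laplacian with standard and Dirichlet vertex conditions -/

/-- Complex functions on the disjoint union of the edges. -/
abbrev EdgeFun : Type _ := ∀ e, Γ.Edge e → ℂ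

variable {Γ}

/-- A function on the edge `[0, ℓ]`, extended to the real line so that one can differentiate it
within `[0, ℓ]` (the values outside `[0, ℓ]` play no role). -/
def onEdge (u : Γ.EdgeFun) (e : E) : ℝ → ℂ := IccExtend (Γ.length_pos e).le (u e)

/-- First derivative along the edge, one-sided at the endpoints. -/
def d1 (u : Γ.EdgeFun) (e : E) : ℝ → ℂ := derivWithin (onEdge u e) (Icc 0 (Γ.length e))

/-- Second derivative along the edge; for functions in `W₂²` it exists almost everywhere. -/
def d2 (u : Γ.EdgeFun) (e : E) : ℝ → ℂ := derivWithin (d1 u e) (Icc 0 (Γ.length e))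

/-- Derivative at an endpoint of the edge, in the direction pointing inside the edge. -/
def inwardDeriv (u : Γ.EdgeFun) (e : E) (b : Bool) : ℂ :=
  if b then -d1 u e (Γ.length e) else d1 u e 0

/-- Lebesgue measure on the edge. -/
def edgeMeasure (Γ : MetricGraph V E) (e : E) : Measure ℝ :=
  volume.restrict (Icc 0 (Γ.length e))

/-- `u` belongs to the Sobolev space `W₂²(Γ) = ⊕ W₂²(Eₙ)`: on each closed edge `u` is continuously
differentiable, its derivative is absolutely continuous, and its second derivative is square
integrable. (Every class in `W₂²` has exactly one representative of this kind.) -/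
def MemW22 (u : Γ.EdgeFun) : Prop :=
  ∀ e, DifferentiableOn ℝ (onEdge u e) (Icc 0 (Γ.length e)) ∧
    AbsolutelyContinuousOnInterval (d1 u e) 0 (Γ.length e) ∧
    MemLp (d2 u e) 2 (Γ.edgeMeasure e)

open Classical in
/-- Standard conditions at `v`: continuity, and the inward derivatives sum up to zero. -/
def StandardAt [Fintype E] (u : Γ.EdgeFun) (v : V) : Prop :=
  (∀ e b e' b', Γ.ends e b = v → Γ.ends e' b' = v →
      u e (Γ.endpoint e b) = u e' (Γ.endpoint e' b')) ∧
    ∑ p : E × Bool with Γ.ends p.1 p.2 = v, inwardDeriv u p.1 p.2 = 0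

/-- Dirichlet condition at `v`. -/
def DirichletAt (u : Γ.EdgeFun) (v : V) : Prop :=
  ∀ e b, Γ.ends e b = v → u e (Γ.endpoint e b) = 0

lemma onEdge_add (u w : Γ.EdgeFun) (e : E) : onEdge (u + w) e = onEdge u e + onEdge w e := rfl

lemma onEdge_smul (c : ℂ) (u : Γ.EdgeFun) (e : E) : onEdge (c • u) e = c • onEdge u e := rfl

lemma d1_add {u w : Γ.EdgeFun} (hu : MemW22 u) (hw : MemW22 w) {e : E} {x : ℝ}
    (hx : x ∈ Icc 0 (Γ.length e)) : d1 (u + w) e x = d1 u e x + d1 w e x := by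
  unfold d1
  rw [onEdge_add]
  exact derivWithin_add ((hu e).1 x hx) ((hw e).1 x hx)

lemma d1_smul (c : ℂ) (u : Γ.EdgeFun) (e : E) : d1 (c • u) e = c • d1 u e := by
  funext x
  unfold d1
  rw [onEdge_smul]
  exact derivWithin_const_smul_field c _

lemma d2_smul (c : ℂ) (u : Γ.EdgeFun) (e : E) : d2 (c • u) e = c • d2 u e := by
  funext x
  unfold d2
  rw [d1_smul]
  exact derivWithin_const_smul_field c _

lemma ae_differentiable_d1 {u : Γ.EdgeFun} (hu : MemW22 u) (e : E) :
    ∀ᵐ x ∂Γ.edgeMeasure e, DifferentiableWithinAt ℝ (d1 u e) (Icc 0 (Γ.length e)) x := by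
  have h := (hu e).2.1.boundedVariationOn.ae_differentiableAt_of_mem_uIcc
  rw [uIcc_of_le (Γ.length_pos e).le] at h
  unfold edgeMeasure
  rw [ae_restrict_iff' measurableSet_Icc]
  filter_upwards [h] with x hx hx'
  exact (hx hx').differentiableWithinAt

lemma d2_add {u w : Γ.EdgeFun} (hu : MemW22 u) (hw : MemW22 w) (e : E) :
    d2 (u + w) e =ᵐ[Γ.edgeMeasure e] d2 u e + d2 w e := by
  filter_upwards [ae_differentiable_d1 hu e, ae_differentiable_d1 hw e,
    ae_restrict_mem measurableSet_Icc] with x h1 h2 hx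
  calc d2 (u + w) e x = derivWithin (d1 u e + d1 w e) (Icc 0 (Γ.length e)) x :=
        derivWithin_congr (fun y hy => d1_add hu hw hy) (d1_add hu hw hx)
    _ = _ := derivWithin_add h1 h2

lemma _root_.AbsolutelyContinuousOnInterval.congr_on {f g : ℝ → ℂ} {a b : ℝ}
    (hf : AbsolutelyContinuousOnInterval f a b) (h : EqOn f g (uIcc a b)) :
    AbsolutelyContinuousOnInterval g a b := by
  rw [absolutelyContinuousOnInterval_iff] at hf ⊢
  intro ε hε
  obtain ⟨δ, hδ, H⟩ := hf ε hε
  refine ⟨δ, hδ, fun I hI hd => ?_⟩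
  convert H I hI hd using 1
  refine Finset.sum_congr rfl fun i hi => ?_
  rw [h (hI.1 i hi).1, h (hI.1 i hi).2]

lemma MemW22.add {u w : Γ.EdgeFun} (hu : MemW22 u) (hw : MemW22 w) : MemW22 (u + w) := by
  refine fun e => ⟨?_, ?_, ?_⟩
  · rw [onEdge_add]
    exact (hu e).1.add (hw e).1
  · refine ((hu e).2.1.add (hw e).2.1).congr_on fun x hx => ?_
    rw [uIcc_of_le (Γ.length_pos e).le] at hx
    exact (d1_add hu hw hx).symm
  · exact (memLp_congr_ae (d2_add hu hw e)).2 ((hu e).2.2.add (hw e).2.2)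

lemma MemW22.smul (c : ℂ) {u : Γ.EdgeFun} (hu : MemW22 u) : MemW22 (c • u) := by
  refine fun e => ⟨?_, ?_, ?_⟩
  · rw [onEdge_smul]
    exact (hu e).1.const_smul c
  · rw [d1_smul]
    exact (hu e).2.1.const_smul c
  · rw [d2_smul]
    exact (hu e).2.2.const_smul c

lemma MemW22.zero : MemW22 (0 : Γ.EdgeFun) := by
  have h0 (e : E) : onEdge (0 : Γ.EdgeFun) e = fun _ => 0 := rfl
  have h1 (e : E) : d1 (0 : Γ.EdgeFun) e = fun _ => 0 := by
    funext x; simp [d1, h0]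
  have h2 (e : E) : d2 (0 : Γ.EdgeFun) e = fun _ => 0 := by
    funext x; simp [d2, h1]
  refine fun e => ⟨?_, ?_, ?_⟩
  · rw [h0]; exact differentiableOn_const _
  · rw [h1]; exact contDiffOn_const.absolutelyContinuousOnInterval
  · rw [h2]; exact MemLp.zero

lemma MemW22.memLp {u : Γ.EdgeFun} (hu : MemW22 u) (e : E) :
    MemLp (onEdge u e) 2 (Γ.edgeMeasure e) := by
  have hc := (hu e).1.continuousOn
  obtain ⟨C, hC⟩ := isCompact_Icc.exists_bound_of_continuousOn hc
  have : IsFiniteMeasure (Γ.edgeMeasure e) := by unfold edgeMeasure; infer_instance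
  refine MemLp.of_bound (hc.aestronglyMeasurable measurableSet_Icc) C ?_
  filter_upwards [ae_restrict_mem measurableSet_Icc] with x hx using hC x hx

variable (Γ) in
/-- The domain of the Laplacian: functions in `W₂²(Γ)` satisfying standard conditions at the
standard vertices and Dirichlet conditions at the Dirichlet vertices. -/
def laplacianDomain [Fintype E] : Submodule ℂ Γ.EdgeFun where
  carrier := {u | MemW22 u ∧ (∀ v ∉ Γ.dirichlet, StandardAt u v) ∧
    ∀ v ∈ Γ.dirichlet, DirichletAt u v}
  zero_mem' := by
    refine ⟨MemW22.zero, fun v _ => ⟨fun _ _ _ _ _ _ => rfl, ?_⟩, fun v _ _ _ _ => rfl⟩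
    refine Finset.sum_eq_zero fun p _ => ?_
    have h1 (e : E) (x : ℝ) : d1 (0 : Γ.EdgeFun) e x = 0 := by
      have h0 : onEdge (0 : Γ.EdgeFun) e = fun _ => 0 := rfl
      simp [d1, h0]
    simp [inwardDeriv, h1]
  add_mem' := by
    rintro u w ⟨hu, hu1, hu2⟩ ⟨hw, hw1, hw2⟩
    refine ⟨hu.add hw, fun v hv => ⟨fun e b e' b' h h' => ?_, ?_⟩, fun v hv e b h => ?_⟩
    · simp only [Pi.add_apply]
      rw [(hu1 v hv).1 e b e' b' h h', (hw1 v hv).1 e b e' b' h h']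
    · have key (e : E) (b : Bool) :
          inwardDeriv (u + w) e b = inwardDeriv u e b + inwardDeriv w e b := by
        have hl := (Γ.length_pos e).le
        cases b
        · simp [inwardDeriv, d1_add hu hw (left_mem_Icc.2 hl)]
        · simp [inwardDeriv, d1_add hu hw (right_mem_Icc.2 hl)]
          ring
      simp only [key]
      rw [Finset.sum_add_distrib, (hu1 v hv).2, (hw1 v hv).2, add_zero]
    · simp only [Pi.add_apply]
      rw [hu2 v hv e b h, hw2 v hv e b h, add_zero]
  smul_mem' := by
    rintro c u ⟨hu, hu1, hu2⟩
    refine ⟨hu.smul c, fun v hv => ⟨fun e b e' b' h h' => ?_, ?_⟩, fun v hv e b h => ?_⟩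
    · simp only [Pi.smul_apply]
      rw [(hu1 v hv).1 e b e' b' h h']
    · have key (e : E) (b : Bool) : inwardDeriv (c • u) e b = c * inwardDeriv u e b := by
        cases b <;> simp [inwardDeriv, d1_smul]
      simp only [key]
      rw [← Finset.mul_sum, (hu1 v hv).2, mul_zero]
    · simp only [Pi.smul_apply]
      rw [hu2 v hv e b h, smul_zero]

variable (Γ) in
/-- The Hilbert space `L₂(Γ) = ⊕ L₂(Eₙ)`. -/
abbrev L2 [Fintype E] : Type _ := PiLp 2 fun e => Lp ℂ 2 (Γ.edgeMeasure e)

variable (Γ) in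
/-- The inclusion of the domain of the Laplacian into `L₂(Γ)`. -/
def toL2 [Fintype E] : Γ.laplacianDomain →ₗ[ℂ] Γ.L2 where
  toFun u := WithLp.toLp 2 fun e => (u.2.1.memLp e).toLp (onEdge u.1 e)
  map_add' u w := by
    ext1 e
    exact MemLp.toLp_add (u.2.1.memLp e) (w.2.1.memLp e)
  map_smul' c u := by
    ext1 e
    exact MemLp.toLp_const_smul c (u.2.1.memLp e)

variable (Γ) in
/-- The Laplacian `L u = -u''` on its domain, with values in `L₂(Γ)`. -/
def laplacian [Fintype E] : Γ.laplacianDomain →ₗ[ℂ] Γ.L2 where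
  toFun u := WithLp.toLp 2 fun e => -((u.2.1 e).2.2.toLp (d2 u.1 e))
  map_add' u w := by
    ext1 e
    have h : ((u + w).2.1 e).2.2.toLp (d2 (u + w).1 e) =
        (u.2.1 e).2.2.toLp (d2 u.1 e) + (w.2.1 e).2.2.toLp (d2 w.1 e) := by
      rw [← MemLp.toLp_add]
      exact MemLp.toLp_congr _ _ (d2_add u.2.1 w.2.1 e)
    simp only [PiLp.add_apply]
    rw [h, neg_add]
  map_smul' c u := by
    ext1 e
    have h : ((c • u).2.1 e).2.2.toLp (d2 (c • u).1 e) = c • (u.2.1 e).2.2.toLp (d2 u.1 e) := by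
      rw [← MemLp.toLp_const_smul]
      exact MemLp.toLp_congr _ _ (Filter.Eventually.of_forall fun x => congrFun (d2_smul c u.1 e) x)
    simp only [PiLp.smul_apply, RingHom.id_apply]
    rw [h, smul_neg]

variable (Γ) in
/-- The space of solutions `ψ` in the domain of the Laplacian of `L ψ = μ ψ`. -/
def eigenspace [Fintype E] (μ : ℝ) : Submodule ℂ Γ.laplacianDomain :=
  LinearMap.ker (Γ.laplacian - (μ : ℂ) • Γ.toL2)

variable (Γ) in
/-- `μ` is a simple eigenvalue: its eigenspace is one-dimensional. -/
def IsSimpleEigenvalue [Fintype E] (μ : ℝ) : Prop := Module.finrank ℂ (Γ.eigenspace μ) = 1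

/-- The nodal domains of `u`: the connected components of the set of those points of the metric
graph at which `u` does not vanish. -/
abbrev NodalDomain (u : Γ.EdgeFun) : Type _ :=
  ConnectedComponents {x : Γ.Space // ∃ e t, Quot.mk _ ⟨e, t⟩ = x ∧ u e t ≠ 0}

end MetricGraph

end

/-! On each edge an eigenfunction for `k ^ 2` is `a cos kx + b sin kx`, and the vertex conditions,
with slopes divided by `k`, involve `k` only through the phases `kℓ_e` modulo `2π`. Suppose that for
some large `k` they have one solution up to multiples, positive at the standard vertices and next to
the Dirichlet ones (`HasPositiveWave`). As soon as each edge contains a full wavelength, it carries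
an even number `N_e ≥ 2` of interior zeros (`exists_phase`). Each vertex then has a nodal domain of
its own and each edge contains `N_e - 1` further ones, so their number is `M + ∑ (N_e - 1) = χ + ∑
N_e`, which has the parity of `χ` (`card_nodalDomain`).

It remains to find such `k` beyond every bound. There are arbitrarily large `k` with all `kℓ_e`
nearly in `2πℤ` (`exists_recurrence`). At `k + s` the secular system is a small perturbation of the
one at `s`, where the ground state of the graph is positive. A sign change in `s` survives the
perturbation, and the intermediate value theorem yields an exact solution.

With a Dirichlet vertex, and apart from an interval with two Dirichlet ends, the phases stay in `(0,
π)`. The values at the vertices determine the wave, and the secular system is the kernel of a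
discrete quadratic form. Its lowest eigenvalue is positive for small `s` and negative just below the
first resonance of the longest edge. Where it vanishes, a Perron–Frobenius argument
(`exists_positive_kernel`) makes the kernel simple and positive.

Without Dirichlet vertices the ground state is the constant at `s = 0`, where the coefficients of
that form are singular and the perturbed phases may have different signs. Written in `t_e = tan (θ_e
/ 2)`, the system is regular at `t = 0`; normalised at a root it is invertible there because a tree
carries no circulation (`isUnit_treeOp_zero`). One scalar defect at the root is left
(`one_sub_treeSol_root`), and it changes sign with `t`. -/

noncomputable section

/-! ### Eigenfunctions as trigonometric waves, and the secular system -/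

namespace MetricGraph

open Filter Topology

/-- The solution `a cos (k x) + b sin (k x)` of `-u'' = k² u`. -/
def wave {R : Type*} [AddCommGroup R] [Module ℝ R] (k : ℝ) (a b : R) (x : ℝ) : R :=
  Real.cos (k * x) • a + Real.sin (k * x) • b

lemma hasDerivAt_wave (k : ℝ) (a b : ℂ) (x : ℝ) :
    HasDerivAt (wave k a b) (wave k (k • b) (-(k • a)) x) x := by
  have hk : HasDerivAt (fun x : ℝ => k * x) k x := by simpa using (hasDerivAt_id x).const_mul k
  have h := (hk.cos.smul_const a).add (hk.sin.smul_const b)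
  convert! h using 1
  simp only [wave, Complex.real_smul]
  push_cast
  ring

lemma hasDerivAt_wave' (k : ℝ) (a b : ℂ) (x : ℝ) :
    HasDerivAt (wave k (k • b) (-(k • a))) (-(k ^ 2 : ℝ) • wave k a b x) x := by
  convert! hasDerivAt_wave k (k • b) (-(k • a)) x using 1
  simp only [wave, Complex.real_smul]
  push_cast
  ring

lemma contDiff_wave (k : ℝ) (a b : ℂ) : ContDiff ℝ 1 (wave k a b) := by
  unfold wave
  have hk : ContDiff ℝ 1 (fun x : ℝ => k * x) := contDiff_const.mul contDiff_id
  exact (hk.cos.smul contDiff_const).add (hk.sin.smul contDiff_const)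

lemma continuous_wave (k : ℝ) (a b : ℂ) : Continuous (wave k a b) := (contDiff_wave k a b).continuous

lemma wave_zero {R : Type*} [AddCommGroup R] [Module ℝ R] (k : ℝ) (a b : R) :
    wave k a b 0 = a := by simp [wave]

lemma map_wave {R R' : Type*} [AddCommGroup R] [Module ℝ R] [AddCommGroup R'] [Module ℝ R']
    (φ : R →ₗ[ℝ] R') (k : ℝ) (a b : R) (x : ℝ) : φ (wave k a b x) = wave k (φ a) (φ b) x := by
  simp [wave]

/-- On an interval, a continuously differentiable function with absolutely continuous derivative
satisfying `-u'' = k² u` almost everywhere is a trigonometric wave. -/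
lemma eq_wave_of_ae_eq {k ℓ : ℝ} (hk : k ≠ 0) (hℓ : 0 < ℓ) {u v : ℝ → ℂ}
    (hu : ∀ x ∈ Icc 0 ℓ, HasDerivWithinAt u (v x) (Icc 0 ℓ) x)
    (hv : AbsolutelyContinuousOnInterval v 0 ℓ)
    (hvd : ∀ᵐ x, x ∈ Icc 0 ℓ →
      HasDerivWithinAt v (-(k ^ 2 : ℝ) • u x) (Icc 0 ℓ) x) :
    ∃ a b : ℂ, ∀ x ∈ Icc 0 ℓ, u x = wave k a b x := by
  have huI : uIcc 0 ℓ = Icc 0 ℓ := uIcc_of_le hℓ.le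
  have hvc : ContinuousOn v (Icc 0 ℓ) := huI ▸ hv.continuousOn
  have hua : AbsolutelyContinuousOnInterval u 0 ℓ := by
    apply ContDiffOn.absolutelyContinuousOnInterval
    rw [huI]
    rw [show (1 : WithTop ℕ∞) = 0 + 1 by simp,
      contDiffOn_succ_iff_derivWithin (uniqueDiffOn_Icc hℓ)]
    refine ⟨fun x hx => (hu x hx).differentiableWithinAt, by simp, contDiffOn_zero.2 ?_⟩
    exact hvc.congr fun x hx => (hu x hx).derivWithin (uniqueDiffOn_Icc hℓ x hx)
  have hcos : AbsolutelyContinuousOnInterval (fun x => Real.cos (k * x)) 0 ℓ :=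
    ContDiffOn.absolutelyContinuousOnInterval
      (ContDiff.contDiffOn (contDiff_const.mul contDiff_id).cos)
  have hsin : AbsolutelyContinuousOnInterval (fun x => Real.sin (k * x)) 0 ℓ :=
    ContDiffOn.absolutelyContinuousOnInterval
      (ContDiff.contDiffOn (contDiff_const.mul contDiff_id).sin)
  have hdk (x : ℝ) : HasDerivAt (fun x : ℝ => k * x) k x := by
    simpa using (hasDerivAt_id x).const_mul k
  have hendpts : ∀ᵐ x : ℝ, x ≠ 0 ∧ x ≠ ℓ := by
    have h0 : ∀ᵐ x : ℝ, x ≠ 0 := Measure.ae_ne volume 0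
    have h1 : ∀ᵐ x : ℝ, x ≠ ℓ := Measure.ae_ne volume ℓ
    filter_upwards [h0, h1] with x hx hx' using ⟨hx, hx'⟩
  have key : ∀ᵐ x, x ∈ Icc 0 ℓ → HasDerivAt u (v x) x ∧ HasDerivAt v (-(k ^ 2 : ℝ) • u x) x := by
    filter_upwards [hvd, hendpts] with x hx hne hxI
    have hn : Icc 0 ℓ ∈ 𝓝 x :=
      Icc_mem_nhds (lt_of_le_of_ne hxI.1 hne.1.symm) (lt_of_le_of_ne hxI.2 hne.2)
    exact ⟨(hu x hxI).hasDerivAt hn, (hx hxI).hasDerivAt hn⟩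
  -- Rotating `(u, v / k)` back by the angle `kx` gives two first integrals. They are absolutely
  -- continuous with derivative zero almost everywhere, hence constant.
  obtain ⟨a, ha⟩ := ((hcos.smul hua).sub
      ((hsin.smul hv).const_smul (k⁻¹))).const_of_ae_hasDerivAt_zero (by
    rw [huI]
    filter_upwards [key] with x hx hxI
    convert! ((hdk x).cos.smul (hx hxI).1).sub (((hdk x).sin.smul (hx hxI).2).const_smul (k⁻¹))
      using 1
    simp only [smul_add, smul_smul, neg_mul, neg_smul, smul_neg]
    rw [show k⁻¹ * (Real.sin (k * x) * k ^ 2) = Real.sin (k * x) * k by field_simp,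
      show k⁻¹ * (Real.cos (k * x) * k) = Real.cos (k * x) by field_simp]
    abel)
  obtain ⟨b, hb⟩ := ((hsin.smul hua).add
      ((hcos.smul hv).const_smul (k⁻¹))).const_of_ae_hasDerivAt_zero (by
    rw [huI]
    filter_upwards [key] with x hx hxI
    convert! ((hdk x).sin.smul (hx hxI).1).add (((hdk x).cos.smul (hx hxI).2).const_smul (k⁻¹))
      using 1
    simp only [smul_add, smul_smul, neg_mul, neg_smul, smul_neg]
    rw [show k⁻¹ * (Real.cos (k * x) * k ^ 2) = Real.cos (k * x) * k by field_simp,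
      show k⁻¹ * (Real.sin (k * x) * k) = Real.sin (k * x) by field_simp]
    abel)
  refine ⟨a, b, fun x hx => ?_⟩
  rw [wave, ← ha x (huI ▸ hx), ← hb x (huI ▸ hx)]
  simp only [Pi.sub_apply, Pi.add_apply, Pi.smul_apply', smul_add, smul_sub, smul_smul]
  have h1 := Real.sin_sq_add_cos_sq (k * x)
  have : u x = (Real.cos (k * x) * Real.cos (k * x) + Real.sin (k * x) * Real.sin (k * x)) • u x := by
    rw [show Real.cos (k * x) * Real.cos (k * x) + Real.sin (k * x) * Real.sin (k * x) = 1 by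
      linarith, one_smul]
  rw [add_smul] at this
  rw [show Real.cos (k * x) * (k⁻¹ * Real.sin (k * x))
    = Real.sin (k * x) * (k⁻¹ * Real.cos (k * x)) by ring]
  rw [sub_add_add_cancel, ← this]

variable {V E : Type*} {Γ : MetricGraph V E}

/-- The value at an endpoint of the wave with coefficients `a`, `b`. -/
def endVal {R : Type*} [AddCommGroup R] [Module ℝ R] (Γ : MetricGraph V E) (k : ℝ) (a b : E → R)
    (e : E) : Bool → R
  | false => a e
  | true => wave k (a e) (b e) (Γ.length e)

/-- The inward derivative, divided by `k`, at an endpoint of the wave with coefficients `a`,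
`b`. -/
def endSlope {R : Type*} [AddCommGroup R] [Module ℝ R] (Γ : MetricGraph V E) (k : ℝ)
    (a b : E → R) (e : E) : Bool → R
  | false => b e
  | true => -wave k (b e) (-a e) (Γ.length e)

open Classical in
/-- The coefficients `a`, `b` of a wave satisfy all vertex conditions. -/
def IsSecular {R : Type*} [AddCommGroup R] [Module ℝ R] [Fintype E] (Γ : MetricGraph V E) (k : ℝ)
    (a b : E → R) : Prop :=
  (∀ v ∉ Γ.dirichlet, (∀ e i e' i', Γ.ends e i = v → Γ.ends e' i' = v →
      endVal Γ k a b e i = endVal Γ k a b e' i') ∧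
    ∑ p : E × Bool with Γ.ends p.1 p.2 = v, endSlope Γ k a b p.1 p.2 = 0) ∧
  ∀ v ∈ Γ.dirichlet, ∀ e i, Γ.ends e i = v → endVal Γ k a b e i = 0

lemma map_endVal {R R' : Type*} [AddCommGroup R] [Module ℝ R] [AddCommGroup R'] [Module ℝ R']
    (φ : R →ₗ[ℝ] R') (k : ℝ) (a b : E → R) (e : E) (i : Bool) :
    endVal Γ k (fun e => φ (a e)) (fun e => φ (b e)) e i = φ (endVal Γ k a b e i) := by
  cases i <;> simp [endVal, map_wave]

lemma map_endSlope {R R' : Type*} [AddCommGroup R] [Module ℝ R] [AddCommGroup R'] [Module ℝ R']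
    (φ : R →ₗ[ℝ] R') (k : ℝ) (a b : E → R) (e : E) (i : Bool) :
    endSlope Γ k (fun e => φ (a e)) (fun e => φ (b e)) e i = φ (endSlope Γ k a b e i) := by
  cases i <;> simp [endSlope, map_wave]

lemma IsSecular.map {R R' : Type*} [AddCommGroup R] [Module ℝ R] [AddCommGroup R'] [Module ℝ R']
    [Fintype E] (φ : R →ₗ[ℝ] R') {k : ℝ} {a b : E → R} (h : IsSecular Γ k a b) :
    IsSecular Γ k (fun e => φ (a e)) (fun e => φ (b e)) := by
  refine ⟨fun v hv => ⟨fun e i e' i' h1 h2 => ?_, ?_⟩, fun v hv e i h1 => ?_⟩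
  · rw [map_endVal, map_endVal, (h.1 v hv).1 e i e' i' h1 h2]
  · simp only [map_endSlope]
    rw [← map_sum, (h.1 v hv).2, map_zero]
  · rw [map_endVal, h.2 v hv e i h1, map_zero]

variable (Γ) in
/-- The function on the metric graph which is a wave on every edge. -/
def waveFun (k : ℝ) (a b : E → ℂ) : Γ.EdgeFun := fun e t => wave k (a e) (b e) t

section waveFun

variable {k : ℝ} {a b : E → ℂ} {u : Γ.EdgeFun}

lemma onEdge_eq (u : Γ.EdgeFun) {e : E} {x : ℝ} (hx : x ∈ Icc 0 (Γ.length e)) :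
    onEdge u e x = u e ⟨x, hx⟩ := IccExtend_of_mem _ _ hx

lemma onEdge_waveFun {e : E} {x : ℝ} (hx : x ∈ Icc 0 (Γ.length e)) :
    onEdge (Γ.waveFun k a b) e x = wave k (a e) (b e) x := by
  rw [onEdge_eq _ hx]; rfl

lemma d1_waveFun {e : E} {x : ℝ} (hx : x ∈ Icc 0 (Γ.length e)) :
    d1 (Γ.waveFun k a b) e x = wave k (k • b e) (-(k • a e)) x := by
  have hu := uniqueDiffOn_Icc (Γ.length_pos e) x hx
  rw [d1, derivWithin_congr (fun y hy => onEdge_waveFun hy) (onEdge_waveFun hx)]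
  exact (hasDerivAt_wave k (a e) (b e) x).hasDerivWithinAt.derivWithin hu

lemma d2_waveFun {e : E} {x : ℝ} (hx : x ∈ Icc 0 (Γ.length e)) :
    d2 (Γ.waveFun k a b) e x = -(k ^ 2 : ℝ) • wave k (a e) (b e) x := by
  have hu := uniqueDiffOn_Icc (Γ.length_pos e) x hx
  rw [d2, derivWithin_congr (fun y hy => d1_waveFun hy) (d1_waveFun hx)]
  exact (hasDerivAt_wave' k (a e) (b e) x).hasDerivWithinAt.derivWithin hu

lemma memW22_waveFun : MemW22 (Γ.waveFun k a b) := by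
  intro e
  have hI : uIcc 0 (Γ.length e) = Icc 0 (Γ.length e) := uIcc_of_le (Γ.length_pos e).le
  refine ⟨?_, ?_, ?_⟩
  · exact ((contDiff_wave k (a e) (b e)).differentiable (by simp)).differentiableOn.congr
      fun x hx => onEdge_waveFun hx
  · exact (contDiff_wave k (k • b e) (-(k • a e))).contDiffOn.absolutelyContinuousOnInterval.congr_on
      fun x hx => (d1_waveFun (hI ▸ hx)).symm
  · have hc : Continuous fun x => -(k ^ 2 : ℝ) • wave k (a e) (b e) x :=
      (continuous_wave k (a e) (b e)).fun_const_smul _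
    obtain ⟨C, hC⟩ := isCompact_Icc.exists_bound_of_continuousOn
      (hc.continuousOn (s := Icc 0 (Γ.length e)))
    have : IsFiniteMeasure (Γ.edgeMeasure e) := by unfold edgeMeasure; infer_instance
    have hm : MemLp (fun x => -(k ^ 2 : ℝ) • wave k (a e) (b e) x) 2 (Γ.edgeMeasure e) := by
      refine MemLp.of_bound hc.aestronglyMeasurable C ?_
      filter_upwards [ae_restrict_mem measurableSet_Icc] with x hx using hC x hx
    refine (memLp_congr_ae ?_).2 hm
    filter_upwards [ae_restrict_mem measurableSet_Icc] with x hx using d2_waveFun hx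

lemma waveFun_endpoint (e : E) (i : Bool) :
    Γ.waveFun k a b e (Γ.endpoint e i) = endVal Γ k a b e i := by
  cases i
  · simp [waveFun, endpoint, endVal, wave_zero]
  · simp [waveFun, endpoint, endVal]

lemma inwardDeriv_waveFun (e : E) (i : Bool) :
    inwardDeriv (Γ.waveFun k a b) e i = k • endSlope Γ k a b e i := by
  have hl := (Γ.length_pos e).le
  cases i
  · simp [inwardDeriv, endSlope, d1_waveFun (left_mem_Icc.2 hl), wave_zero]
  · simp only [inwardDeriv, endSlope, d1_waveFun (right_mem_Icc.2 hl), if_true, wave, smul_neg,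
      smul_add, smul_smul, mul_comm k]

variable [Fintype E]

lemma waveFun_mem_laplacianDomain_iff (hk : k ≠ 0) :
    Γ.waveFun k a b ∈ Γ.laplacianDomain ↔ IsSecular Γ k a b := by
  change (MemW22 _ ∧ (∀ v ∉ Γ.dirichlet, StandardAt _ v) ∧ ∀ v ∈ Γ.dirichlet, DirichletAt _ v) ↔ _
  simp only [memW22_waveFun, true_and, StandardAt, DirichletAt, waveFun_endpoint,
    inwardDeriv_waveFun, IsSecular, ← Finset.smul_sum, smul_eq_zero, hk, false_or]

lemma mem_eigenspace_iff {μ : ℝ} (ψ : Γ.laplacianDomain) :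
    ψ ∈ Γ.eigenspace μ ↔
      ∀ e, ∀ᵐ x, x ∈ Icc 0 (Γ.length e) → d2 ψ.1 e x = -μ • onEdge ψ.1 e x := by
  rw [eigenspace, LinearMap.mem_ker, LinearMap.sub_apply, LinearMap.smul_apply, sub_eq_zero]
  have hex : Γ.laplacian ψ = (μ : ℂ) • Γ.toL2 ψ ↔ ∀ e,
      -((ψ.2.1 e).2.2.toLp (d2 ψ.1 e)) = (μ : ℂ) • (ψ.2.1.memLp e).toLp (onEdge ψ.1 e) := by
    constructor
    · intro h e
      exact congrArg (fun f : Γ.L2 => f e) h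
    · intro h
      ext1 e
      exact h e
  rw [hex]
  refine forall_congr' fun e => ?_
  rw [← MemLp.toLp_neg, ← MemLp.toLp_const_smul, MemLp.toLp_eq_toLp_iff, edgeMeasure,
    EventuallyEq, ae_restrict_iff' measurableSet_Icc]
  refine eventually_congr (Eventually.of_forall fun x => imp_congr_right fun _ => ?_)
  simp only [Pi.neg_apply, Pi.smul_apply, smul_eq_mul, neg_smul, Complex.real_smul]
  rw [neg_eq_iff_eq_neg]

lemma waveFun_mem_eigenspace (h : Γ.waveFun k a b ∈ Γ.laplacianDomain) :
    (⟨_, h⟩ : Γ.laplacianDomain) ∈ Γ.eigenspace (k ^ 2) := by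
  rw [mem_eigenspace_iff]
  refine fun e => Eventually.of_forall fun x hx => ?_
  rw [d2_waveFun hx, onEdge_waveFun hx]

lemma exists_eq_waveFun (hk : k ≠ 0) {ψ : Γ.laplacianDomain} (h : ψ ∈ Γ.eigenspace (k ^ 2)) :
    ∃ a b : E → ℂ, ψ.1 = Γ.waveFun k a b := by
  rw [mem_eigenspace_iff] at h
  have key (e : E) : ∃ a b : ℂ, ∀ x ∈ Icc 0 (Γ.length e), onEdge ψ.1 e x = wave k a b x := by
    refine eq_wave_of_ae_eq (v := d1 ψ.1 e) hk (Γ.length_pos e) (fun x hx => ?_)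
      (ψ.2.1 e).2.1 ?_
    · exact ((ψ.2.1 e).1 x hx).hasDerivWithinAt
    · have hd := ae_differentiable_d1 ψ.2.1 e
      rw [edgeMeasure, ae_restrict_iff' measurableSet_Icc] at hd
      filter_upwards [hd, h e] with x h1 h2 hx
      rw [← h2 hx]
      exact (h1 hx).hasDerivWithinAt
  choose a b hab using key
  refine ⟨a, b, ?_⟩
  funext e t
  rw [waveFun, ← hab e t t.2, onEdge_eq]

end waveFun

/-- If the real secular system has, up to multiples, exactly one solution, then `k²` is a simple
eigenvalue, and its eigenfunctions are the multiples of that solution. -/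
lemma isSimpleEigenvalue_of_unique [Fintype E] {k : ℝ} (hk : k ≠ 0) {a b : E → ℝ}
    (h : IsSecular Γ k a b) (hne : ∃ e, a e ≠ 0 ∨ b e ≠ 0)
    (huniq : ∀ a' b' : E → ℝ, IsSecular Γ k a' b' → ∃ c : ℝ, ∀ e, a' e = c * a e ∧ b' e = c * b e) :
    Γ.IsSimpleEigenvalue (k ^ 2) ∧ ∀ ψ ∈ Γ.eigenspace (k ^ 2), ∃ c : ℂ,
      ∀ e t, ψ.1 e t = c * (wave k (a e) (b e) t : ℝ) := by
  have hwave (c : ℂ) (e : E) (x : ℝ) :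
      wave k (c * a e) (c * b e) x = c * (wave k (a e) (b e) x : ℝ) := by
    simp only [wave, Complex.real_smul, smul_eq_mul]; push_cast; ring
  have hall : ∀ ψ ∈ Γ.eigenspace (k ^ 2), ∃ c : ℂ,
      ∀ e t, ψ.1 e t = c * (wave k (a e) (b e) t : ℝ) := by
    intro ψ hψ
    obtain ⟨a', b', hab⟩ := exists_eq_waveFun hk hψ
    have hs : IsSecular Γ k a' b' := by
      rw [← waveFun_mem_laplacianDomain_iff hk, ← hab]; exact ψ.2
    -- The system has real coefficients, so real and imaginary parts solve it separately.
    obtain ⟨c1, h1⟩ := huniq _ _ (hs.map Complex.reLm)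
    obtain ⟨c2, h2⟩ := huniq _ _ (hs.map Complex.imLm)
    refine ⟨⟨c1, c2⟩, fun e t => ?_⟩
    rw [hab, ← hwave, waveFun]
    congr 1
    · apply Complex.ext
      · simpa using (h1 e).1
      · simpa using (h2 e).1
    · apply Complex.ext
      · simpa using (h1 e).2
      · simpa using (h2 e).2
  refine ⟨?_, hall⟩
  have hsC := (h.map Complex.ofRealCLM.toLinearMap)
  have hdom := (waveFun_mem_laplacianDomain_iff hk).2 hsC
  set ψ₀ : Γ.eigenspace (k ^ 2) := ⟨⟨_, hdom⟩, waveFun_mem_eigenspace hdom⟩ with hψ₀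
  have hval (e : E) (t : Γ.Edge e) : ψ₀.1.1 e t = (wave k (a e) (b e) t : ℝ) := by
    have := hwave 1 e t
    rw [one_mul, one_mul, one_mul] at this
    exact this
  have hne0 : ψ₀ ≠ 0 := by
    intro h0
    have hz (e : E) (t : Γ.Edge e) : wave k (a e) (b e) t = 0 := by
      have := hval e t
      rw [h0] at this
      exact Complex.ofReal_eq_zero.1 this.symm
    obtain ⟨e, he⟩ := hne
    have ha : a e = 0 := by
      simpa [wave] using hz e ⟨0, left_mem_Icc.2 (Γ.length_pos e).le⟩
    have hb : b e ≠ 0 := he.resolve_left (not_not.2 ha)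
    have hkp : 0 < |k| := abs_pos.2 hk
    have hl := Γ.length_pos e
    -- With `a e = 0` the wave is `b e * sin (kx)`; here `0 < |k| x ≤ 1`, so the sine does not
    -- vanish.
    set x := min (Γ.length e) (1 / |k|) with hx
    have hx0 : 0 < x := lt_min hl (by positivity)
    have := hz e ⟨x, hx0.le, min_le_left _ _⟩
    rw [wave, ha, smul_zero, zero_add, smul_eq_mul, mul_eq_zero] at this
    have hs := this.resolve_right hb
    have h1 : |k| * x ≤ 1 := by
      have := mul_le_mul_of_nonneg_left (min_le_right (Γ.length e) (1 / |k|)) hkp.le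
      rwa [mul_one_div_cancel hkp.ne'] at this
    have h2 : 0 < Real.sin (|k| * x) :=
      Real.sin_pos_of_pos_of_le_one (by positivity) h1
    rcases abs_choice k with hc | hc <;> rw [hc] at h2
    · exact h2.ne' hs
    · rw [neg_mul, Real.sin_neg] at h2
      simp [hs] at h2
  rw [IsSimpleEigenvalue, finrank_eq_one_iff_of_nonzero' ψ₀ hne0]
  intro w
  obtain ⟨c, hc⟩ := hall w.1 w.2
  refine ⟨c, ?_⟩
  ext e t
  change c * ψ₀.1.1 e t = w.1.1 e t
  rw [hc, hval]

end MetricGraph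

/-! ### Counting nodal domains by phase functions -/

namespace MetricGraph

open Filter Topology

variable {V E : Type*} {Γ : MetricGraph V E}

section NodalCount

/-- The label of the nodal domains of a function whose zeros on the edge `e` are the points where
an increasing function takes integer values, the last of them in the interior being `N e`: a vertex
or an interval in the interior of an edge. -/
def nodalLabel (Γ : MetricGraph V E) (N : E → ℤ) (e : E) (n : ℤ) : V ⊕ Σ e, Ioo (0 : ℤ) (N e) :=
  if h : 0 < n ∧ n < N e then .inr ⟨e, n, h⟩
  else if n ≤ 0 then .inl (Γ.ends e false) else .inl (Γ.ends e true)

variable {N : E → ℤ} {g : E → ℝ → ℝ} {u : Γ.EdgeFun}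

lemma nodalLabel_of_le {e : E} {n : ℤ} (h : n ≤ 0) :
    nodalLabel Γ N e n = .inl (Γ.ends e false) := by
  rw [nodalLabel, dif_neg (by omega), if_pos h]

lemma nodalLabel_of_ge {e : E} {n : ℤ} (hN : 0 < N e) (h : N e ≤ n) :
    nodalLabel Γ N e n = .inl (Γ.ends e true) := by
  rw [nodalLabel, dif_neg (by omega), if_neg (by omega)]

lemma nodalLabel_of_mem {e : E} {n : ℤ} (h : n ∈ Ioo 0 (N e)) :
    nodalLabel Γ N e n = .inr ⟨e, n, h⟩ := by
  exact dif_pos (c := 0 < n ∧ n < N e) h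

/-- A point of the metric graph at which `u` does not vanish. -/
def nodalPoint (u : Γ.EdgeFun) (e : E) (t : Γ.Edge e) (h : u e t ≠ 0) :
    {x : Γ.Space // ∃ e t, Quot.mk _ ⟨e, t⟩ = x ∧ u e t ≠ 0} :=
  ⟨Quot.mk _ ⟨e, t⟩, e, t, rfl, h⟩

lemma floor_bounds_of_nonint {x : ℝ} (h : ∀ n : ℤ, x ≠ n) :
    (⌊x⌋ : ℝ) < x ∧ x < ⌊x⌋ + 1 :=
  ⟨lt_of_le_of_ne (Int.floor_le x) (h _).symm, Int.lt_floor_add_one x⟩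

lemma nonint_of_mem_Ioo {x : ℝ} {n : ℤ} (h : x ∈ Ioo (n : ℝ) (n + 1)) (j : ℤ) : x ≠ j := by
  rintro rfl
  have h1 : n < j := by exact_mod_cast h.1
  have h2 : j < n + 1 := by exact_mod_cast h.2
  omega

lemma floor_of_mem_Ioo {x : ℝ} {n : ℤ} (h : x ∈ Ioo (n : ℝ) (n + 1)) : ⌊x⌋ = n :=
  Int.floor_eq_iff.2 ⟨h.1.le, h.2⟩

/-- By monotonicity the points of an edge with phase in `(n, n + 1)` form an interval without zeros,
whose image in the graph is connected. -/
lemma component_eq_of_floor_eq (hmono : ∀ e, StrictMono (g e))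
    (hzero : ∀ e (t : Γ.Edge e), u e t = 0 ↔ ∃ n : ℤ, g e t = n) {e : E} {s t : Γ.Edge e}
    (hs : u e s ≠ 0) (ht : u e t ≠ 0) (hst : ⌊g e s⌋ = ⌊g e t⌋) :
    (nodalPoint u e s hs : NodalDomain u) = nodalPoint u e t ht := by
  set n := ⌊g e s⌋ with hn
  set I : Set (Γ.Edge e) := {τ | g e τ ∈ Ioo (n : ℝ) (n + 1)} with hI
  have hIpre : IsPreconnected I := by
    rw [← Topology.IsInducing.subtypeVal.isPreconnected_image]
    refine OrdConnected.isPreconnected ⟨?_⟩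
    rintro _ ⟨x, hx, rfl⟩ _ ⟨y, hy, rfl⟩ z hz
    exact ⟨⟨z, x.2.1.trans hz.1, hz.2.trans y.2.2⟩,
      ⟨hx.1.trans_le ((hmono e).monotone hz.1), ((hmono e).monotone hz.2).trans_lt hy.2⟩, rfl⟩
  have hnz (τ : I) : u e τ ≠ 0 := by
    rw [Ne, hzero]
    rintro ⟨j, hj⟩
    exact nonint_of_mem_Ioo τ.2 j hj
  have := isPreconnected_iff_preconnectedSpace.1 hIpre
  have hF : Continuous fun τ : I => nodalPoint u e τ.1 (hnz τ) :=
    Continuous.subtype_mk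
      (continuous_quot_mk.comp (continuous_sigmaMk.comp continuous_subtype_val)) _
  have hsI : s ∈ I := floor_bounds_of_nonint fun j hj => hs ((hzero e s).2 ⟨j, hj⟩)
  have htI : t ∈ I := by
    rw [hI, mem_ofPred_eq, hst]
    exact floor_bounds_of_nonint fun j hj => ht ((hzero e t).2 ⟨j, hj⟩)
  rw [ConnectedComponents.coe_eq_coe']
  exact (isPreconnected_range hF).subset_connectedComponent ⟨⟨t, htI⟩, rfl⟩ ⟨⟨s, hsI⟩, rfl⟩

/-- The value of the floor function near an endpoint of an edge. -/
def endFloor (N : E → ℤ) (e : E) (i : Bool) : ℤ := if i then N e else 0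

/-- Phases on the edge run from `[0, 1)` to `(N e, N e + 1]`, so only the first and the last unit
interval carry vertex labels. -/
lemma nodalLabel_eq_inl (hN : ∀ e, 0 < N e) (hmono : ∀ e, StrictMono (g e))
    (h0 : ∀ e, g e 0 ∈ Ico 0 1) (h1 : ∀ e, g e (Γ.length e) ∈ Ioc (N e : ℝ) (N e + 1))
    (hzero : ∀ e (t : Γ.Edge e), u e t = 0 ↔ ∃ n : ℤ, g e t = n) {e : E} {s : Γ.Edge e}
    (hs : u e s ≠ 0) {v : V} (hv : nodalLabel Γ N e ⌊g e s⌋ = .inl v) :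
    ∃ i, Γ.ends e i = v ∧ ⌊g e s⌋ = endFloor N e i := by
  have hb := floor_bounds_of_nonint fun j hj => hs ((hzero e s).2 ⟨j, hj⟩)
  have hlo : 0 ≤ ⌊g e s⌋ :=
    Int.floor_nonneg.2 ((h0 e).1.trans ((hmono e).monotone s.2.1))
  have hhi : ⌊g e s⌋ < N e + 1 := by
    have := hb.1.trans_le (((hmono e).monotone s.2.2).trans (h1 e).2)
    exact_mod_cast this
  rcases hlo.eq_or_lt with h | h
  · rw [nodalLabel_of_le h.symm.le] at hv
    exact ⟨false, Sum.inl_injective hv, h.symm⟩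
  · by_cases h' : ⌊g e s⌋ < N e
    · rw [nodalLabel_of_mem ⟨h, h'⟩] at hv
      simp at hv
    · rw [nodalLabel_of_ge (hN e) (not_lt.1 h')] at hv
      refine ⟨true, Sum.inl_injective hv, ?_⟩
      simp only [endFloor, if_true]
      omega

/-- This includes Dirichlet endpoints, even a right one of phase `N e + 1`. Hence the label respects
the gluing and descends to the graph. -/
lemma nodalLabel_endpoint (hN : ∀ e, 0 < N e) (h0 : ∀ e, g e 0 ∈ Ico 0 1)
    (h1 : ∀ e, g e (Γ.length e) ∈ Ioc (N e : ℝ) (N e + 1)) (e : E) (i : Bool) :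
    nodalLabel Γ N e ⌊g e (Γ.endpoint e i)⌋ = .inl (Γ.ends e i) := by
  cases i
  · refine nodalLabel_of_le (le_of_eq ?_)
    simpa [endpoint] using h0 e
  · exact nodalLabel_of_ge (hN e) (Int.le_floor.2 (h1 e).1.le)

/-- The number of nodal domains of a function whose zeros are prescribed by increasing functions
on the edges taking integer values, and which vanishes at no standard vertex. -/
theorem card_nodalDomain [Fintype V] [Fintype E] (hN : ∀ e, 0 < N e)
    (hmono : ∀ e, StrictMono (g e)) (hcont : ∀ e, Continuous (g e))
    (h0 : ∀ e, g e 0 ∈ Ico 0 1) (h1 : ∀ e, g e (Γ.length e) ∈ Ioc (N e : ℝ) (N e + 1))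
    (hzero : ∀ e (t : Γ.Edge e), u e t = 0 ↔ ∃ n : ℤ, g e t = n)
    (hglue : ∀ e i e' i', Γ.ends e i = Γ.ends e' i' →
      (u e (Γ.endpoint e i) = 0 ↔ u e' (Γ.endpoint e' i') = 0))
    (hstd : ∀ e i, Γ.ends e i ∉ Γ.dirichlet → u e (Γ.endpoint e i) ≠ 0) :
    Finite (NodalDomain u) ∧
      (Nat.card (NodalDomain u) : ℤ) = Fintype.card V + ∑ e, (N e - 1) := by
  set T := V ⊕ Σ e, Ioo (0 : ℤ) (N e) with hT
  -- With discrete labels a continuous colouring is constant on components; it remains to see that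
  -- it separates them and takes all values.
  let _ : TopologicalSpace T := ⊥
  have : DiscreteTopology T := ⟨rfl⟩
  have hcompat (p q : Σ e, Γ.Edge e) (h : Γ.Glue p q) :
      nodalLabel Γ N p.1 ⌊g p.1 p.2⌋ = nodalLabel Γ N q.1 ⌊g q.1 q.2⌋ := by
    obtain ⟨e, i, e', i', rfl, rfl, h⟩ := h
    rw [nodalLabel_endpoint hN h0 h1, nodalLabel_endpoint hN h0 h1, h]
  have hnzc (p q : Σ e, Γ.Edge e) (h : Γ.Glue p q) : (u p.1 p.2 ≠ 0) = (u q.1 q.2 ≠ 0) := by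
    obtain ⟨e, i, e', i', rfl, rfl, h⟩ := h
    exact propext (not_congr (hglue e i e' i' h))
  let color : Γ.Space → T := Quot.lift (fun p => nodalLabel Γ N p.1 ⌊g p.1 p.2⌋) hcompat
  let nz : Γ.Space → Prop := Quot.lift (fun p => u p.1 p.2 ≠ 0) hnzc
  have hnz : ∀ x : {x : Γ.Space // ∃ e t, Quot.mk _ ⟨e, t⟩ = x ∧ u e t ≠ 0}, nz x.1 := by
    rintro ⟨_, e, t, rfl, h⟩
    exact h
  -- The floor of the phase is locally constant where the phase is not an integer, that is, off the
  -- zeros.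
  have hopen (s : Set T) : IsOpen {x : Γ.Space | nz x ∧ color x ∈ s} := by
    refine isOpen_coinduced.2 (isOpen_sigma_iff.2 fun e => ?_)
    change IsOpen {t : Γ.Edge e | u e t ≠ 0 ∧ nodalLabel Γ N e ⌊g e t⌋ ∈ s}
    rw [isOpen_iff_mem_nhds]
    rintro t ⟨ht, hts⟩
    have hb := floor_bounds_of_nonint fun j hj => ht ((hzero e t).2 ⟨j, hj⟩)
    have hc : Continuous fun t : Γ.Edge e => g e t := (hcont e).comp continuous_subtype_val
    filter_upwards [hc.continuousAt.eventually (Ioo_mem_nhds hb.1 hb.2)] with t' ht'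
    refine ⟨fun h => ?_, ?_⟩
    · obtain ⟨j, hj⟩ := (hzero e t').1 h
      exact nonint_of_mem_Ioo ht' j hj
    · rwa [floor_of_mem_Ioo ht']
  have hcol : Continuous fun x : {x : Γ.Space // ∃ e t, Quot.mk _ ⟨e, t⟩ = x ∧ u e t ≠ 0} =>
      color x.1 := by
    refine ⟨fun s _ => ?_⟩
    convert (hopen s).preimage continuous_subtype_val using 1
    ext x
    exact ⟨fun h => ⟨hnz x, h⟩, fun h => h.2⟩
  have hinj : Function.Injective hcol.connectedComponentsLift := by
    intro x y
    obtain ⟨⟨_, e, s, rfl, hs⟩, rfl⟩ := ConnectedComponents.surjective_coe x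
    obtain ⟨⟨_, e', s', rfl, hs'⟩, rfl⟩ := ConnectedComponents.surjective_coe y
    intro hxy
    change nodalLabel Γ N e ⌊g e s⌋ = nodalLabel Γ N e' ⌊g e' s'⌋ at hxy
    change (nodalPoint u e s hs : NodalDomain u) = nodalPoint u e' s' hs'
    rcases hl : nodalLabel Γ N e ⌊g e s⌋ with v | ⟨e₁, n, hn⟩
    · obtain ⟨i, hi, hf⟩ := nodalLabel_eq_inl hN hmono h0 h1 hzero hs hl
      obtain ⟨i', hi', hf'⟩ := nodalLabel_eq_inl hN hmono h0 h1 hzero hs' (hxy ▸ hl)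
      by_cases hv : v ∈ Γ.dirichlet
      -- A Dirichlet vertex has a single endpoint, so both points lie in the same end interval of
      -- one edge.
      · obtain ⟨p, hp⟩ := ncard_eq_one.1 (Γ.degree_dirichlet v hv)
        have h1 : (e, i) = p := by rw [← mem_singleton_iff, ← hp]; exact hi
        have h2 : (e', i') = p := by rw [← mem_singleton_iff, ← hp]; exact hi'
        obtain ⟨rfl, rfl⟩ := Prod.mk.inj (h1.trans h2.symm)
        exact component_eq_of_floor_eq hmono hzero hs hs' (hf.trans hf'.symm)
      -- At a standard vertex the function is nonzero, so both points are joined to the vertex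
      -- itself.
      · have hend (e : E) (i : Bool) (hi : Γ.ends e i = v) :
            ⌊g e (Γ.endpoint e i)⌋ = endFloor N e i := by
          have hne := hstd e i (hi ▸ hv)
          have hb := floor_bounds_of_nonint fun j hj =>
            hne ((hzero e (Γ.endpoint e i)).2 ⟨j, hj⟩)
          cases i
          · simpa [endpoint, endFloor] using h0 e
          · refine floor_of_mem_Ioo ⟨(h1 e).1, lt_of_le_of_ne (h1 e).2 fun h => ?_⟩
            exact hne ((hzero e (Γ.endpoint e true)).2 ⟨N e + 1, by push_cast; exact h⟩)
        rw [component_eq_of_floor_eq hmono hzero hs (hstd e i (hi ▸ hv))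
            (hf.trans (hend e i hi).symm),
          component_eq_of_floor_eq hmono hzero hs' (hstd e' i' (hi' ▸ hv))
            (hf'.trans (hend e' i' hi').symm)]
        congr 1
        exact Subtype.ext (Quot.sound ⟨e, i, e', i', rfl, rfl, hi.trans hi'.symm⟩)
    · have aux {e₂ : E} {j : ℤ} (h : nodalLabel Γ N e₂ j = .inr ⟨e₁, n, hn⟩) : e₂ = e₁ ∧ j = n := by
        rw [nodalLabel] at h
        split_ifs at h with h'
        · obtain ⟨rfl, h⟩ := Sigma.mk.inj (Sum.inr_injective h)
          exact ⟨rfl, congrArg Subtype.val (eq_of_heq h)⟩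
      obtain ⟨rfl, ha⟩ := aux hl
      obtain ⟨rfl, hb⟩ := aux (hxy ▸ hl)
      exact component_eq_of_floor_eq hmono hzero hs hs' (ha.trans hb.symm)
  have hpoint (e : E) (y : ℝ) (hy0 : g e 0 ≤ y) (hy1 : y ≤ g e (Γ.length e)) (n : ℤ)
      (hyn : y ∈ Ioo (n : ℝ) (n + 1)) :
      ∃ x, hcol.connectedComponentsLift x = nodalLabel Γ N e n := by
    obtain ⟨t, ht, rfl⟩ := intermediate_value_Icc (Γ.length_pos e).le (hcont e).continuousOn
      ⟨hy0, hy1⟩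
    have hne : u e ⟨t, ht⟩ ≠ 0 := by
      rw [Ne, hzero]
      rintro ⟨j, hj⟩
      exact nonint_of_mem_Ioo hyn j hj
    refine ⟨(nodalPoint u e ⟨t, ht⟩ hne : NodalDomain u), ?_⟩
    change nodalLabel Γ N e ⌊g e t⌋ = _
    rw [floor_of_mem_Ioo hyn]
  have hsurj : Function.Surjective hcol.connectedComponentsLift := by
    have hNr (e : E) : (1 : ℝ) ≤ N e := by exact_mod_cast hN e
    rintro (v | ⟨e, n, hn⟩)
    · obtain ⟨e, i, rfl⟩ := Γ.ends_surjective v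
      have := hNr e
      obtain ⟨ha, hb⟩ := h0 e
      obtain ⟨hc, hd⟩ := h1 e
      cases i
      · rw [← nodalLabel_of_le (N := N) le_rfl]
        -- A midpoint avoids the integers, also when the endpoint itself is a zero.
        exact hpoint e ((g e 0 + 1) / 2) (by linarith) (by linarith) 0
          ⟨by push_cast; linarith, by push_cast; linarith⟩
      · rw [← nodalLabel_of_ge (hN e) le_rfl]
        exact hpoint e ((N e + g e (Γ.length e)) / 2) (by linarith) (by linarith) (N e)
          ⟨by linarith, by linarith⟩
    · rw [← nodalLabel_of_mem hn]
      have h2 : (1 : ℝ) ≤ n := by exact_mod_cast hn.1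
      have h3 : (n : ℝ) + 1 ≤ N e := by exact_mod_cast hn.2
      exact hpoint e (n + 1 / 2) (by linarith [(h0 e).2]) (by linarith [(h1 e).1]) n
        ⟨by linarith, by linarith⟩
  have hbij : Function.Bijective hcol.connectedComponentsLift := ⟨hinj, hsurj⟩
  refine ⟨Finite.of_injective _ hinj, ?_⟩
  rw [Nat.card_eq_of_bijective _ hbij, hT, Nat.card_sum, Nat.card_eq_fintype_card, Nat.card_sigma]
  push_cast
  congr 1
  refine Finset.sum_congr rfl fun e _ => ?_
  rw [Nat.card_eq_fintype_card, Fintype.card_ofFinset, Int.card_Ioo]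
  have := hN e
  omega

end NodalCount

end MetricGraph

/-! ### Parity of the zeros on an edge, and recurrence of the phases -/

namespace MetricGraph

open Filter Topology

/-- A wave on an interval of at least two wavelengths, which is positive near both endpoints, has
an even number of zeros in the interior; they are given by a phase function. -/
lemma exists_phase {k ℓ a b : ℝ} (hk : 0 < k) (hkℓ : 2 * Real.pi ≤ k * ℓ)
    (h0 : 0 ≤ a) (h0' : a = 0 → 0 < b) (h1 : 0 ≤ wave k a b ℓ)
    (h1' : wave k a b ℓ = 0 → 0 < -wave k b (-a) ℓ) :
    ∃ (N : ℤ) (g : ℝ → ℝ), 0 < N ∧ Even N ∧ StrictMono g ∧ Continuous g ∧ g 0 ∈ Ico 0 1 ∧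
      g ℓ ∈ Ioc (N : ℝ) (N + 1) ∧ ∀ x, wave k a b x = 0 ↔ ∃ n : ℤ, g x = n := by
  have hpi := Real.pi_pos
  -- Polar form of `b + ia`: the wave is `A sin (kx + β)`, and positivity near the left end places
  -- `β` in `[0, π)`.
  set z : ℂ := ⟨b, a⟩ with hz
  set A := ‖z‖ with hA
  set β := z.arg with hβ
  have hb : A * Real.cos β = b := Complex.norm_mul_cos_arg z
  have ha : A * Real.sin β = a := Complex.norm_mul_sin_arg z
  have hβ0 : 0 ≤ β := Complex.arg_nonneg_iff.2 h0
  have hβ1 : β < Real.pi := by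
    rw [hβ, Complex.arg_lt_pi_iff]
    by_cases h : a = 0
    · exact Or.inl (h0' h).le
    · exact Or.inr h
  have hA0 : 0 < A := by
    refine norm_pos_iff.2 fun h => ?_
    have hre : b = 0 := congrArg Complex.re h
    have him : a = 0 := congrArg Complex.im h
    exact (h0' him).ne' hre
  set g : ℝ → ℝ := fun x => (k * x + β) / Real.pi with hg
  have hgpi (x : ℝ) : k * x + β = g x * Real.pi := by simp only [hg]; field_simp
  have hw (x : ℝ) : wave k a b x = A * Real.sin (g x * Real.pi) := by
    rw [← hgpi, Real.sin_add, wave, ← ha, ← hb]; simp only [smul_eq_mul]; ring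
  have hw' (x : ℝ) : wave k b (-a) x = A * Real.cos (g x * Real.pi) := by
    rw [← hgpi, Real.cos_add, wave, ← ha, ← hb]; simp only [smul_eq_mul]; ring
  have hceil1 := Int.ceil_lt_add_one (g ℓ)
  have hceil2 := Int.le_ceil (g ℓ)
  have hℓ : 2 ≤ g ℓ := by
    simp only [hg]
    rw [le_div_iff₀ hpi]
    linarith
  have hmono : StrictMono g := by
    intro x y hxy
    simp only [hg]
    gcongr
  -- The ceiling minus one, and not the floor, leaves a zero at the right endpoint uncounted.
  refine ⟨⌈g ℓ⌉ - 1, g, ?_, ?_, hmono, ?_, ?_, ?_, ?_⟩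
  · have : (2 : ℝ) ≤ ⌈g ℓ⌉ := hℓ.trans hceil2
    have : (2 : ℤ) ≤ ⌈g ℓ⌉ := by exact_mod_cast this
    omega
  · rcases Int.even_or_odd (⌈g ℓ⌉ - 1) with h | ⟨j, hj⟩
    · exact h
    exfalso
    have hj' : (⌈g ℓ⌉ : ℝ) = 2 * j + 2 := by
      have : ⌈g ℓ⌉ = 2 * j + 2 := by omega
      exact_mod_cast this
    -- For odd `N` the wave is `-A sin (rπ)` at the right end: negative if `r < 1`, and zero with
    -- inward slope `-A` if `r = 1`.
    set r := g ℓ - (2 * j + 1) with hr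
    have hr0 : 0 < r := by linarith
    have hr1 : r ≤ 1 := by linarith
    have hgr : g ℓ * Real.pi = r * Real.pi + Real.pi + j * (2 * Real.pi) := by rw [hr]; ring
    have hs : Real.sin (g ℓ * Real.pi) = -Real.sin (r * Real.pi) := by
      rw [hgr, Real.sin_add_int_mul_two_pi, Real.sin_add_pi]
    have hc : Real.cos (g ℓ * Real.pi) = -Real.cos (r * Real.pi) := by
      rw [hgr, Real.cos_add_int_mul_two_pi, Real.cos_add_pi]
    rw [hw, hs] at h1 h1'
    rw [hw', hc] at h1'
    rcases hr1.eq_or_lt with h | h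
    · rw [h, one_mul, Real.sin_pi, Real.cos_pi] at h1'
      have := h1' (by simp)
      linarith
    · have : 0 < Real.sin (r * Real.pi) :=
        Real.sin_pos_of_pos_of_lt_pi (by positivity) (by nlinarith)
      nlinarith [mul_pos hA0 this]
  · simp only [hg]; fun_prop
  · simp only [hg, mul_zero, zero_add]
    exact ⟨by positivity, (div_lt_one hpi).2 hβ1⟩
  · push_cast
    exact ⟨by linarith, by linarith⟩
  · intro x
    rw [hw, mul_eq_zero, or_iff_right hA0.ne', Real.sin_eq_zero_iff]
    constructor
    · rintro ⟨n, hn⟩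
      exact ⟨n, (mul_right_cancel₀ hpi.ne' hn).symm⟩
    · rintro ⟨n, hn⟩
      exact ⟨n, by rw [hn]⟩

variable {V E : Type*} {Γ : MetricGraph V E}

/-- The real secular system at `k` has, up to multiples, exactly one solution, and that solution is
positive on the graph near every vertex. -/
def HasPositiveWave [Fintype E] (Γ : MetricGraph V E) (k : ℝ) : Prop :=
  ∃ a b : E → ℝ, IsSecular Γ k a b ∧
    (∀ e i, Γ.ends e i ∉ Γ.dirichlet → 0 < endVal Γ k a b e i) ∧
    (∀ e i, Γ.ends e i ∈ Γ.dirichlet → 0 < endSlope Γ k a b e i) ∧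
    ∀ a' b' : E → ℝ, IsSecular Γ k a' b' → ∃ c : ℝ, ∀ e, a' e = c * a e ∧ b' e = c * b e

/-- The wave is positive near both ends of every edge, so each edge has an even number `N e` of
interior zeros; the count minus `χ` is `∑ N e`. The bound on `k` ensures `N e > 0`, which separates
the domains of the two ends. -/
theorem HasPositiveWave.isSimpleEigenvalue [Fintype V] [Fintype E] [Nonempty E] {k : ℝ}
    (h : HasPositiveWave Γ k) (hk : 0 < k) (hkℓ : ∀ e, 2 * Real.pi ≤ k * Γ.length e) :
    Γ.IsSimpleEigenvalue (k ^ 2) ∧ ∀ ψ ∈ Γ.eigenspace (k ^ 2), ψ ≠ 0 →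
      Finite (NodalDomain ψ.1) ∧ Even ((Nat.card (NodalDomain ψ.1) : ℤ) - Γ.eulerChar) := by
  obtain ⟨a, b, hsec, hstd, hdir, huniq⟩ := h
  have hval (e : E) (i : Bool) : 0 ≤ endVal Γ k a b e i := by
    by_cases hD : Γ.ends e i ∈ Γ.dirichlet
    · exact (hsec.2 _ hD e i rfl).ge
    · exact (hstd e i hD).le
  have hslope (e : E) (i : Bool) (h : endVal Γ k a b e i = 0) : 0 < endSlope Γ k a b e i := by
    by_cases hD : Γ.ends e i ∈ Γ.dirichlet
    · exact hdir e i hD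
    · exact absurd h (hstd e i hD).ne'
  have hph (e : E) := exists_phase hk (hkℓ e) (hval e false) (hslope e false) (hval e true)
    (hslope e true)
  obtain ⟨e₀⟩ := ‹Nonempty E›
  have hne : ∃ e, a e ≠ 0 ∨ b e ≠ 0 := by
    refine ⟨e₀, ?_⟩
    by_contra! h
    exact (hslope e₀ false h.1).ne' h.2
  obtain ⟨hsimple, hall⟩ := isSimpleEigenvalue_of_unique hk.ne' hsec hne huniq
  refine ⟨hsimple, fun ψ hψ hψ0 => ?_⟩
  obtain ⟨c, hc⟩ := hall ψ hψ
  have hc0 : c ≠ 0 := by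
    rintro rfl
    refine hψ0 (Subtype.ext ?_)
    funext e t
    simpa using hc e t
  choose N g hN hNe hmono hcont h0 h1 hz using hph
  have hzero (e : E) (t : Γ.Edge e) : ψ.1 e t = 0 ↔ wave k (a e) (b e) t = 0 := by
    rw [hc, mul_eq_zero, or_iff_right hc0, Complex.ofReal_eq_zero]
  have hendzero (e : E) (i : Bool) :
      ψ.1 e (Γ.endpoint e i) = 0 ↔ endVal Γ k a b e i = 0 := by
    rw [hzero]
    cases i <;> simp [endpoint, endVal, wave_zero]
  obtain ⟨hfin, hcard⟩ := card_nodalDomain (u := ψ.1) hN hmono hcont h0 h1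
    (fun e t => (hzero e t).trans (hz e t))
    (fun e i e' i' h => by
      rw [hendzero, hendzero]
      by_cases hD : Γ.ends e i ∈ Γ.dirichlet
      · rw [hsec.2 _ hD e i rfl, hsec.2 _ hD e' i' h.symm]
      · rw [(hsec.1 _ hD).1 e i e' i' rfl h.symm])
    (fun e i hD => by rw [Ne, hendzero]; exact (hstd e i hD).ne')
  refine ⟨hfin, ?_⟩
  rw [hcard, eulerChar, Finset.sum_sub_distrib]
  simp only [Finset.sum_const, Finset.card_univ, mul_one, nsmul_eq_mul]
  rw [show (Fintype.card V : ℤ) + (∑ e, N e - Fintype.card E) - (Fintype.card V - Fintype.card E)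
    = ∑ e, N e by ring]
  exact Finset.even_sum _ fun e _ => hNe e

/-- If positive waves exist for arbitrarily large frequencies, then there are infinitely many
simple eigenvalues with nodal counts of the parity of the Euler characteristic. -/
theorem exists_strictMono_of_hasPositiveWave [Fintype V] [Fintype E] [Nonempty E]
    (h : ∀ K : ℝ, ∃ k > K, HasPositiveWave Γ k) :
    ∃ μ : ℕ → ℝ, StrictMono μ ∧ ∀ j, Γ.IsSimpleEigenvalue (μ j) ∧
      ∀ ψ ∈ Γ.eigenspace (μ j), ψ ≠ 0 →
        Finite (NodalDomain ψ.1) ∧ Even ((Nat.card (NodalDomain ψ.1) : ℤ) - Γ.eulerChar) := by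
  obtain ⟨K, hK⟩ : ∃ K : ℝ, ∀ e, 2 * Real.pi / Γ.length e ≤ K := by
    obtain ⟨K, hK⟩ := (Set.finite_range fun e => 2 * Real.pi / Γ.length e).bddAbove
    exact ⟨K, fun e => hK ⟨e, rfl⟩⟩
  have hK0 : 0 < K := by
    obtain ⟨e⟩ := ‹Nonempty E›
    have := Γ.length_pos e
    exact lt_of_lt_of_le (by positivity) (hK e)
  have step : ∀ x : {k : ℝ // K < k ∧ HasPositiveWave Γ k},
      ∃ y : {k : ℝ // K < k ∧ HasPositiveWave Γ k}, x.1 < y.1 := by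
    rintro ⟨x, hx, -⟩
    obtain ⟨y, hy, hy'⟩ := h x
    exact ⟨⟨y, hx.trans hy, hy'⟩, hy⟩
  choose next hnext using step
  obtain ⟨k₀, hk₀, hk₀'⟩ := h K
  let κ : ℕ → {k : ℝ // K < k ∧ HasPositiveWave Γ k} := fun n => next^[n] ⟨k₀, hk₀, hk₀'⟩
  have hκ : StrictMono fun n => (κ n).1 := by
    refine strictMono_nat_of_lt_succ fun n => ?_
    simp only [κ, Function.iterate_succ_apply']
    exact hnext _
  have hpos (n : ℕ) : 0 < (κ n).1 := hK0.trans (κ n).2.1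
  refine ⟨fun n => (κ n).1 ^ 2, fun m n hmn => ?_, fun j => ?_⟩
  · exact pow_lt_pow_left₀ (hκ hmn) (hpos m).le two_ne_zero
  · refine (κ j).2.2.isSimpleEigenvalue (hpos j) fun e => ?_
    rw [← div_le_iff₀ (Γ.length_pos e)]
    exact (hK e).trans (κ j).2.1.le

/-- Simultaneous recurrence: there are arbitrarily large `k` for which all `k ℓ e` are close to
multiples of `2π`. -/
lemma exists_recurrence {E : Type*} [Fintype E] (ℓ : E → ℝ) {ε : ℝ} (hε : 0 < ε) (K : ℝ) :
    ∃ k > K, ∃ m : E → ℤ, ∀ e, |k * ℓ e - m e * (2 * Real.pi)| < ε := by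
  have : Fact (0 < 2 * Real.pi) := ⟨Real.two_pi_pos⟩
  set x : E → AddCircle (2 * Real.pi) := fun e => (ℓ e : ℝ) with hx
  -- In a compact torus the multiples of a point return arbitrarily late to any neighbourhood of
  -- zero.
  have hcl := mapClusterPt_zero_atTop_nsmul x
  have hball : Metric.ball (0 : E → AddCircle (2 * Real.pi)) ε ∈ 𝓝 0 := Metric.ball_mem_nhds _ hε
  obtain ⟨n, hn, hn'⟩ := ((mapClusterPt_iff_frequently.1 hcl _ hball).and_eventually
    (eventually_gt_atTop ⌈K⌉₊)).exists
  refine ⟨n, lt_of_le_of_lt (Nat.le_ceil K) (by exact_mod_cast hn'), ?_⟩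
  -- The norm on the circle is the distance to the nearest multiple of `2π`, which rounding selects.
  refine ⟨fun e => round ((2 * Real.pi)⁻¹ * (n * ℓ e)), fun e => ?_⟩
  rw [← AddCircle.norm_eq (p := 2 * Real.pi)]
  have h1 := (dist_pi_lt_iff hε).1 (Metric.mem_ball.1 hn) e
  rw [Pi.zero_apply, dist_zero_right] at h1
  convert! h1 using 2
  simp [hx, ← nsmul_eq_mul]

end MetricGraph

/-! ### Discrete forms on the vertices: a Perron–Frobenius argument -/

namespace MetricGraph

open Filter Topology

variable {V E : Type*} {Γ : MetricGraph V E}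

/-- A nonempty set of vertices closed under passing to the other endpoint of an edge consists of
all vertices of a connected graph. -/
lemma forall_mem_of_connected (hconn : Γ.graph.Connected) {W : Set V}
    (hW : ∀ e i, Γ.ends e i ∈ W → Γ.ends e (!i) ∈ W) {v₀ : V} (h₀ : v₀ ∈ W) (v : V) : v ∈ W := by
  obtain ⟨p⟩ := hconn.preconnected v₀ v
  induction p with
  | nil => exact h₀
  | cons h _ ih =>
    refine ih ?_
    obtain ⟨-, ⟨e, rfl, rfl⟩ | ⟨e, rfl, rfl⟩⟩ := (SimpleGraph.fromRel_adj _ _ _).1 h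
    · exact hW e false h₀
    · exact hW e true h₀

lemma eq_of_mem_dirichlet {v : V} (hv : v ∈ Γ.dirichlet) {e e' : E} {i i' : Bool}
    (h : Γ.ends e i = v) (h' : Γ.ends e' i' = v) : e = e' ∧ i = i' := by
  obtain ⟨p, hp⟩ := ncard_eq_one.1 (Γ.degree_dirichlet v hv)
  have h1 : (e, i) = p := by rw [← mem_singleton_iff, ← hp]; exact h
  have h2 : (e', i') = p := by rw [← mem_singleton_iff, ← hp]; exact h'
  exact Prod.mk.inj (h1.trans h2.symm)

-- Each endpoint belongs to exactly one vertex. This regrouping is behind every summation by parts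
-- below.
open Classical in
lemma sum_vertex_sum_endpoint [Fintype V] [Fintype E] (F : V → E × Bool → ℝ) :
    ∑ v, ∑ p : E × Bool with Γ.ends p.1 p.2 = v, F v p =
      ∑ e, (F (Γ.ends e false) (e, false) + F (Γ.ends e true) (e, true)) := by
  have h1 : ∑ v, ∑ p : E × Bool with Γ.ends p.1 p.2 = v, F v p =
      ∑ p : E × Bool, F (Γ.ends p.1 p.2) p := by
    rw [← Finset.sum_fiberwise (s := Finset.univ) (g := fun p : E × Bool => Γ.ends p.1 p.2)]
    refine Finset.sum_congr rfl fun v _ => Finset.sum_congr rfl fun p hp => ?_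
    rw [(Finset.mem_filter.1 hp).2]
  rw [h1, Fintype.sum_prod_type]
  refine Finset.sum_congr rfl fun e _ => ?_
  rw [Fintype.sum_bool, add_comm]

section DiscreteForm

variable [Fintype E]

open Classical in
/-- The sum of the inward fluxes at a vertex for the discrete operator with weights `c`, `d`. -/
def flux (Γ : MetricGraph V E) (c d : E → ℝ) (f : V → ℝ) (v : V) : ℝ :=
  ∑ p : E × Bool with Γ.ends p.1 p.2 = v, (d p.1 * f (Γ.ends p.1 (!p.2)) - c p.1 * f v)

/-- The discrete bilinear form with weights `c`, `d`. -/
def bilin (Γ : MetricGraph V E) (c d : E → ℝ) (f g : V → ℝ) : ℝ :=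
  ∑ e, (c e * (f (Γ.ends e false) * g (Γ.ends e false) + f (Γ.ends e true) * g (Γ.ends e true)) -
    d e * (f (Γ.ends e false) * g (Γ.ends e true) + f (Γ.ends e true) * g (Γ.ends e false)))

variable {c d : E → ℝ}

lemma sum_mul_flux [Fintype V] (f g : V → ℝ) :
    ∑ v, g v * flux Γ c d f v = -bilin Γ c d f g := by
  classical
  simp only [flux, Finset.mul_sum]
  rw [sum_vertex_sum_endpoint (Γ := Γ)
    (fun v p => g v * (d p.1 * f (Γ.ends p.1 (!p.2)) - c p.1 * f v)), bilin,
    ← Finset.sum_neg_distrib]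
  refine Finset.sum_congr rfl fun e _ => ?_
  simp only [Bool.not_false, Bool.not_true]
  ring

lemma bilin_add_smul (f g : V → ℝ) (t : ℝ) :
    bilin Γ c d (f + t • g) (f + t • g) =
      bilin Γ c d f f + 2 * t * bilin Γ c d f g + t ^ 2 * bilin Γ c d g g := by
  simp only [bilin, Finset.mul_sum, ← Finset.sum_add_distrib]
  refine Finset.sum_congr rfl fun e _ => ?_
  simp only [Pi.add_apply, Pi.smul_apply, smul_eq_mul]
  ring

lemma bilin_smul (f : V → ℝ) (t : ℝ) :
    bilin Γ c d (t • f) (t • f) = t ^ 2 * bilin Γ c d f f := by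
  simp only [bilin, Finset.mul_sum]
  refine Finset.sum_congr rfl fun e _ => ?_
  simp only [Pi.smul_apply, smul_eq_mul]
  ring

lemma flux_smul (f : V → ℝ) (t : ℝ) (v : V) : flux Γ c d (t • f) v = t * flux Γ c d f v := by
  simp only [flux, Finset.mul_sum]
  refine Finset.sum_congr rfl fun e _ => ?_
  simp only [Pi.smul_apply, smul_eq_mul]
  ring

lemma flux_sub (f g : V → ℝ) (v : V) :
    flux Γ c d (f - g) v = flux Γ c d f v - flux Γ c d g v := by
  simp only [flux, ← Finset.sum_sub_distrib]
  refine Finset.sum_congr rfl fun e _ => ?_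
  simp only [Pi.sub_apply]
  ring

/-- Functions on the vertices vanishing at the Dirichlet vertices. -/
def dirichletZero (Γ : MetricGraph V E) : Set (V → ℝ) := {f | ∀ v ∈ Γ.dirichlet, f v = 0}

/-- Absolute values keep the squares and can only increase products of neighbouring values, which
enter with the negative weight `-d`. -/
lemma bilin_abs_le (hd : ∀ e, 0 < d e) (f : V → ℝ) :
    bilin Γ c d (fun v => |f v|) (fun v => |f v|) ≤ bilin Γ c d f f := by
  refine Finset.sum_le_sum fun e _ => ?_
  have h1 := le_abs_self (f (Γ.ends e false) * f (Γ.ends e true))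
  rw [abs_mul] at h1
  simp only [abs_mul_abs_self]
  nlinarith [mul_le_mul_of_nonneg_left h1 (hd e).le]

/-- A strong maximum principle: at a standard zero the flux is a sum of nonnegative terms `d * f`,
so all neighbouring values vanish, and zeros spread along the connected graph. -/
lemma eq_zero_of_nonneg_of_flux (hconn : Γ.graph.Connected) (hd : ∀ e, 0 < d e) {f : V → ℝ}
    (hpos : ∀ v, 0 ≤ f v) (h : ∀ v ∉ Γ.dirichlet, flux Γ c d f v = 0) {v₀ : V}
    (hv₀ : v₀ ∉ Γ.dirichlet) (hfv₀ : f v₀ = 0) (v : V) : f v = 0 := by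
  classical
  have hstd (v : V) (hv : v ∉ Γ.dirichlet) (hfv : f v = 0) (e : E) (i : Bool)
      (he : Γ.ends e i = v) : f (Γ.ends e (!i)) = 0 := by
    have h1 := h v hv
    simp only [flux, hfv, mul_zero, sub_zero] at h1
    rw [Finset.sum_eq_zero_iff_of_nonneg
      (fun p _ => mul_nonneg (hd p.1).le (hpos _))] at h1
    have := h1 (e, i) (by simp [he])
    exact (mul_eq_zero.1 this).resolve_left (hd e).ne'
  -- Dirichlet vertices satisfy no flux equation. They have only the neighbour from which they are
  -- reached, so vanishing neighbours are made part of the property that spreads.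
  set W : Set V := {v | f v = 0 ∧ ∀ e i, Γ.ends e i = v → f (Γ.ends e (!i)) = 0} with hW
  have : v ∈ W := by
    refine forall_mem_of_connected hconn (W := W) (fun e i he => ?_)
      (v₀ := v₀) ⟨hfv₀, hstd v₀ hv₀ hfv₀⟩ v
    have h0 := he.2 e i rfl
    refine ⟨h0, ?_⟩
    by_cases hD : Γ.ends e (!i) ∈ Γ.dirichlet
    · intro e' i' h'
      obtain ⟨rfl, rfl⟩ := eq_of_mem_dirichlet hD h' rfl
      rw [Bool.not_not]
      exact he.1
    · exact hstd _ hD h0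
  exact this.1

variable [Fintype V]

/-- A zero of a nonnegative form minimises it, so its first variation in the direction of the
indicator of `v` vanishes. -/
lemma flux_eq_zero_of_minimal (hQ : ∀ f ∈ dirichletZero Γ, 0 ≤ bilin Γ c d f f) {f : V → ℝ}
    (hf : f ∈ dirichletZero Γ) (hf0 : bilin Γ c d f f = 0) {v : V} (hv : v ∉ Γ.dirichlet) :
    flux Γ c d f v = 0 := by
  classical
  set g : V → ℝ := Pi.single v 1 with hg
  have hgD : g ∈ dirichletZero Γ := fun w hw =>
    Pi.single_eq_of_ne (fun h : w = v => hv (h ▸ hw)) _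
  have hb : bilin Γ c d f g = -flux Γ c d f v := by
    have := sum_mul_flux (Γ := Γ) (c := c) (d := d) f g
    rw [Finset.sum_eq_single v (fun w _ hw => by rw [hg, Pi.single_eq_of_ne hw, zero_mul])
      (by simp), hg, Pi.single_eq_same, one_mul] at this
    rw [this, neg_neg]
  have key (t : ℝ) : 0 ≤ 2 * t * bilin Γ c d f g + t ^ 2 * bilin Γ c d g g := by
    have := hQ (f + t • g) fun w hw => by
      simp [hf w hw, hgD w hw]
    rw [bilin_add_smul, hf0] at this
    linarith
  by_contra hne
  set B := bilin Γ c d f g with hB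
  set G := bilin Γ c d g g with hG
  have hB0 : B ≠ 0 := by rw [hb]; simpa using hne
  have hG0 : 0 ≤ G := hQ g hgD
  -- Near the minimiser `-B / G` of the quadratic; `G + 1` also covers `G = 0`.
  have h1 := key (-B / (G + 1))
  have h2 : 2 * (-B / (G + 1)) * B + (-B / (G + 1)) ^ 2 * G =
      -(B ^ 2 * (G + 2)) / (G + 1) ^ 2 := by
    field_simp
    ring
  rw [h2] at h1
  have h3 : 0 < B ^ 2 * (G + 2) / (G + 1) ^ 2 := by positivity
  rw [neg_div] at h1
  linarith

lemma bilin_eq_zero_of_flux {f : V → ℝ} (hf : f ∈ dirichletZero Γ)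
    (h : ∀ v ∉ Γ.dirichlet, flux Γ c d f v = 0) : bilin Γ c d f f = 0 := by
  rw [← neg_eq_zero, ← sum_mul_flux]
  refine Finset.sum_eq_zero fun v _ => ?_
  by_cases hv : v ∈ Γ.dirichlet
  · rw [hf v hv, zero_mul]
  · rw [h v hv, mul_zero]

/-- A nonnegative discrete form with positive off-diagonal weights and nontrivial kernel has a
one-dimensional kernel, spanned by a function positive at all standard vertices. -/
theorem exists_positive_kernel (hconn : Γ.graph.Connected) (hd : ∀ e, 0 < d e)
    (hQ : ∀ f ∈ dirichletZero Γ, 0 ≤ bilin Γ c d f f) {f₀ : V → ℝ} (hf₀ : f₀ ∈ dirichletZero Γ)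
    (hne : f₀ ≠ 0) (h0 : bilin Γ c d f₀ f₀ = 0) :
    ∃ f ∈ dirichletZero Γ, (∀ v ∉ Γ.dirichlet, 0 < f v) ∧ (∀ v ∉ Γ.dirichlet, flux Γ c d f v = 0) ∧
      ∀ g ∈ dirichletZero Γ, (∀ v ∉ Γ.dirichlet, flux Γ c d g v = 0) → ∃ t : ℝ, g = t • f := by
  have habs (f : V → ℝ) (hf : f ∈ dirichletZero Γ) (h : bilin Γ c d f f = 0) :
      (∀ v ∉ Γ.dirichlet, flux Γ c d (fun v => |f v|) v = 0) := by
    have hD : (fun v => |f v|) ∈ dirichletZero Γ := fun v hv => by simp [hf v hv]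
    intro v hv
    refine flux_eq_zero_of_minimal hQ hD (le_antisymm ?_ (hQ _ hD)) hv
    rw [← h]
    exact bilin_abs_le hd f
  -- By the maximum principle for `|f|`, a kernel function with a zero at a standard vertex is zero.
  -- This gives positivity, and simplicity after subtracting a multiple of `|f₀|`.
  have hzero (f : V → ℝ) (hf : f ∈ dirichletZero Γ) (h : bilin Γ c d f f = 0) (v₀ : V)
      (hv₀ : v₀ ∉ Γ.dirichlet) (hfv₀ : f v₀ = 0) : f = 0 := by
    funext v
    exact abs_eq_zero.1 (eq_zero_of_nonneg_of_flux hconn hd (fun v => abs_nonneg (f v))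
      (habs f hf h) hv₀ (by simp [hfv₀]) v)
  obtain ⟨v₀, hv₀⟩ : ∃ v, f₀ v ≠ 0 := Function.ne_iff.1 hne
  have hv₀D : v₀ ∉ Γ.dirichlet := fun h => hv₀ (hf₀ v₀ h)
  have hpos (v : V) (hv : v ∉ Γ.dirichlet) : 0 < |f₀ v| := by
    refine abs_pos.2 fun h => hne (hzero f₀ hf₀ h0 v hv h)
  have hD : (fun v => |f₀ v|) ∈ dirichletZero Γ := fun v hv => by simp [hf₀ v hv]
  refine ⟨fun v => |f₀ v|, hD, hpos, habs f₀ hf₀ h0, fun g hg hgf => ?_⟩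
  refine ⟨g v₀ / |f₀ v₀|, ?_⟩
  rw [← sub_eq_zero]
  refine hzero _ (fun v hv => ?_) (bilin_eq_zero_of_flux (fun v hv => ?_) fun v hv => ?_) v₀ hv₀D ?_
  · simp [hg v hv, hf₀ v hv]
  · simp [hg v hv, hf₀ v hv]
  · rw [flux_sub, flux_smul, hgf v hv, habs f₀ hf₀ h0 v hv]; simp
  · have := (hpos v₀ hv₀D).ne'
    simp only [Pi.sub_apply, Pi.smul_apply, smul_eq_mul]
    field_simp
    simp

end DiscreteForm

/-! ### The secular system as the kernel of a discrete form -/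

section Secular

variable {k : ℝ}

/-- When no edge length is resonant, the slopes of a wave are determined by its values. -/
lemma endSlope_eq {a b : E → ℝ} {e : E} (hS : Real.sin (k * Γ.length e) ≠ 0) (i : Bool) :
    endSlope Γ k a b e i = (1 / Real.sin (k * Γ.length e)) * endVal Γ k a b e (!i) -
      (Real.cos (k * Γ.length e) / Real.sin (k * Γ.length e)) * endVal Γ k a b e i := by
  have h := Real.sin_sq_add_cos_sq (k * Γ.length e)
  cases i
  · simp only [endSlope, endVal, wave, smul_eq_mul, Bool.not_false]
    field_simp
    ring
  · simp only [endSlope, endVal, wave, smul_eq_mul, Bool.not_true]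
    field_simp
    linear_combination (a e) * h

/-- The cotangents of given phases, the diagonal weights of a discrete form. -/
def cotWeight (θ : E → ℝ) (e : E) : ℝ := Real.cos (θ e) / Real.sin (θ e)

/-- The cosecants of given phases, the off-diagonal weights of a discrete form. -/
def cscWeight (θ : E → ℝ) (e : E) : ℝ := 1 / Real.sin (θ e)

variable [Fintype E]

/-- As all sines are positive, waves correspond to their vertex values and the vertex conditions
become zero flux. At a Dirichlet vertex the slope is `d` times the value at the other end, a
standard vertex by `hDD`. -/
theorem hasPositiveWave_of_kernel [Fintype V] (hconn : Γ.graph.Connected)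
    (hDD : ∀ e i, Γ.ends e i ∈ Γ.dirichlet → Γ.ends e (!i) ∉ Γ.dirichlet)
    (hS : ∀ e, 0 < Real.sin (k * Γ.length e))
    (hQ : ∀ f ∈ dirichletZero Γ, 0 ≤ bilin Γ (cotWeight fun e => k * Γ.length e)
      (cscWeight fun e => k * Γ.length e) f f) {f₀ : V → ℝ} (hf₀ : f₀ ∈ dirichletZero Γ)
    (hne : f₀ ≠ 0) (h0 : bilin Γ (cotWeight fun e => k * Γ.length e)
      (cscWeight fun e => k * Γ.length e) f₀ f₀ = 0) :
    HasPositiveWave Γ k := by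
  classical
  set c : E → ℝ := cotWeight fun e => k * Γ.length e with hc
  set d : E → ℝ := cscWeight fun e => k * Γ.length e with hd
  have hd0 (e : E) : 0 < d e := one_div_pos.2 (hS e)
  obtain ⟨f, hfD, hfpos, hff, huniq⟩ := exists_positive_kernel hconn hd0 hQ hf₀ hne h0
  set a : E → ℝ := fun e => f (Γ.ends e false) with ha
  set b : E → ℝ := fun e => d e * f (Γ.ends e true) - c e * f (Γ.ends e false) with hb
  have hval (e : E) (i : Bool) : endVal Γ k a b e i = f (Γ.ends e i) := by
    cases i
    · rfl
    · have := (hS e).ne'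
      simp only [endVal, wave, ha, hb, hc, hd, cotWeight, cscWeight, smul_eq_mul]
      field_simp
      ring
  have hslope (e : E) (i : Bool) :
      endSlope Γ k a b e i = d e * f (Γ.ends e (!i)) - c e * f (Γ.ends e i) := by
    rw [endSlope_eq (hS e).ne', hval, hval]; rfl
  refine ⟨a, b, ⟨fun v hv => ⟨fun e i e' i' h h' => ?_, ?_⟩, fun v hv e i h => ?_⟩,
    fun e i hD => ?_, fun e i hD => ?_, fun a' b' h => ?_⟩
  · rw [hval, hval, h, h']
  · rw [← hff v hv, flux]
    refine Finset.sum_congr rfl fun p hp => ?_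
    rw [hslope, (Finset.mem_filter.1 hp).2]
  · rw [hval, h, hfD v hv]
  · rw [hval]; exact hfpos _ hD
  · rw [hslope, hfD _ hD, mul_zero, sub_zero]
    exact mul_pos (hd0 e) (hfpos _ (hDD e i hD))
  · choose ε ι hει using Γ.ends_surjective
    -- By the vertex conditions the value does not depend on the endpoint chosen at `v`.
    set g : V → ℝ := fun v => endVal Γ k a' b' (ε v) (ι v) with hg
    have hval' (e : E) (i : Bool) : endVal Γ k a' b' e i = g (Γ.ends e i) := by
      by_cases hD : Γ.ends e i ∈ Γ.dirichlet
      · rw [h.2 _ hD e i rfl]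
        exact (h.2 _ hD _ _ (hει _)).symm
      · exact (h.1 _ hD).1 _ _ _ _ rfl (hει _)
    have hslope' (e : E) (i : Bool) :
        endSlope Γ k a' b' e i = d e * g (Γ.ends e (!i)) - c e * g (Γ.ends e i) := by
      rw [endSlope_eq (hS e).ne', hval', hval']; rfl
    obtain ⟨t, ht⟩ := huniq g (fun v hv => h.2 v hv _ _ (hει v)) (fun v hv => by
      rw [← (h.1 v hv).2, flux]
      refine Finset.sum_congr rfl fun p hp => ?_
      rw [hslope', (Finset.mem_filter.1 hp).2])
    refine ⟨t, fun e => ⟨?_, ?_⟩⟩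
    · have := hval' e false
      rw [ht] at this
      exact this
    · have := hslope' e false
      rw [ht] at this
      simp only [endSlope, Pi.smul_apply, smul_eq_mul, Bool.not_false] at this
      rw [this, hb]
      ring

/-- A connected graph with an edge joining two Dirichlet vertices is an interval, on which positive
waves exist for arbitrarily large frequencies. -/
theorem exists_hasPositiveWave_of_interval (hconn : Γ.graph.Connected) {e : E}
    (h0 : Γ.ends e false ∈ Γ.dirichlet) (h1 : Γ.ends e true ∈ Γ.dirichlet) (K : ℝ) :
    ∃ k > K, HasPositiveWave Γ k := by
  have hends (i : Bool) : Γ.ends e i ∈ Γ.dirichlet := by cases i <;> assumption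
  have hall (e' : E) : e' = e := by
    have : Γ.ends e' false ∈ range (Γ.ends e) := by
      refine forall_mem_of_connected hconn (W := range (Γ.ends e)) ?_ (v₀ := Γ.ends e false)
        ⟨false, rfl⟩ _
      rintro e₁ i ⟨j, hj⟩
      obtain ⟨rfl, rfl⟩ := eq_of_mem_dirichlet (hends j) rfl hj.symm
      exact ⟨_, rfl⟩
    obtain ⟨j, hj⟩ := this
    exact (eq_of_mem_dirichlet (hends j) hj.symm rfl).1
  have hD (e' : E) (i : Bool) : Γ.ends e' i ∈ Γ.dirichlet := by rw [hall e']; exact hends i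
  have hDv (v : V) : v ∈ Γ.dirichlet := by
    obtain ⟨e', i, rfl⟩ := Γ.ends_surjective v
    exact hD e' i
  have hℓ := Γ.length_pos e
  have hpi := Real.pi_pos
  obtain ⟨n, hn⟩ := exists_nat_gt (K * Γ.length e / Real.pi)
  -- An odd multiple of `π` makes `sin (kx)` vanish at both ends with inward slope `1` at each.
  set k : ℝ := (Real.pi + n * (2 * Real.pi)) / Γ.length e with hk
  have hkℓ (e' : E) : k * Γ.length e' = Real.pi + n * (2 * Real.pi) := by
    rw [hall e', hk]; field_simp
  have hsin (e' : E) : Real.sin (k * Γ.length e') = 0 := by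
    rw [hkℓ, Real.sin_add_nat_mul_two_pi, Real.sin_pi]
  have hcos (e' : E) : Real.cos (k * Γ.length e') = -1 := by
    rw [hkℓ, Real.cos_add_nat_mul_two_pi, Real.cos_pi]
  refine ⟨k, ?_, fun _ => 0, fun _ => 1, ⟨fun v hv => absurd (hDv v) hv, fun v hv e' i h => ?_⟩,
    fun e' i h => absurd (hD e' i) h, fun e' i _ => ?_, fun a' b' h => ⟨b' e, fun e' => ⟨?_, ?_⟩⟩⟩
  · rw [gt_iff_lt, hk, lt_div_iff₀ hℓ]
    rw [div_lt_iff₀ hpi] at hn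
    have : 0 ≤ (n : ℝ) * Real.pi := by positivity
    linarith
  · cases i <;> simp [endVal, wave, hsin]
  · cases i <;> simp [endSlope, wave, hsin, hcos]
  · rw [mul_zero]
    exact h.2 _ (hD e' false) e' false rfl
  · rw [mul_one, hall e']

end Secular

end MetricGraph

/-! ### Graphs with a Dirichlet vertex: the lowest eigenvalue changes sign -/

namespace MetricGraph

open Filter Topology

variable {V E : Type*} {Γ : MetricGraph V E} [Fintype V] [Fintype E]

/-- The unit sphere in the space of functions vanishing at the Dirichlet vertices. -/
def dirichletSphere (Γ : MetricGraph V E) : Set (V → ℝ) :=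
  dirichletZero Γ ∩ {f | ∑ v, f v ^ 2 = 1}

omit [Fintype E] in
lemma isCompact_dirichletSphere : IsCompact (dirichletSphere Γ) := by
  refine (isCompact_univ_pi fun _ : V => isCompact_Icc (a := (-1 : ℝ)) (b := 1)).of_isClosed_subset
    ?_ ?_
  · refine IsClosed.inter ?_ (isClosed_eq (by fun_prop) continuous_const)
    have : dirichletZero Γ = ⋂ v ∈ Γ.dirichlet, {f : V → ℝ | f v = 0} := by
      ext f; simp [dirichletZero]
    rw [this]
    exact isClosed_biInter fun v _ => isClosed_eq (continuous_apply v) continuous_const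
  · intro f hf v _
    have h1 : f v ^ 2 ≤ 1 := by
      rw [← hf.2]
      exact Finset.single_le_sum (f := fun v => f v ^ 2) (fun w _ => sq_nonneg _)
        (Finset.mem_univ v)
    exact abs_le.1 ((sq_le_one_iff_abs_le_one _).1 h1)

omit [Fintype E] in
lemma sq_le_one_of_mem_dirichletSphere {f : V → ℝ} (hf : f ∈ dirichletSphere Γ) (v : V) :
    f v ^ 2 ≤ 1 := by
  rw [← hf.2]
  exact Finset.single_le_sum (f := fun v => f v ^ 2) (fun w _ => sq_nonneg _) (Finset.mem_univ v)

omit [Fintype E] in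
lemma exists_smul_mem_dirichletSphere {f : V → ℝ} (hf : f ∈ dirichletZero Γ) (hne : f ≠ 0) :
    ∃ t : ℝ, 0 < t ∧ t • f ∈ dirichletSphere Γ := by
  obtain ⟨v, hv⟩ := Function.ne_iff.1 hne
  have hs : 0 < ∑ v, f v ^ 2 :=
    Finset.sum_pos' (fun w _ => sq_nonneg _) ⟨v, Finset.mem_univ v, sq_pos_iff.2 hv⟩
  refine ⟨(Real.sqrt (∑ v, f v ^ 2))⁻¹, by positivity, fun w hw => by simp [hf w hw], ?_⟩
  simp only [mem_ofPred_eq, Pi.smul_apply, smul_eq_mul, mul_pow, ← Finset.mul_sum, inv_pow]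
  rw [Real.sq_sqrt hs.le, inv_mul_cancel₀ hs.ne']

omit [Fintype V] in
lemma continuous_bilin : Continuous fun p : ((E → ℝ) × (E → ℝ)) × (V → ℝ) =>
    bilin Γ p.1.1 p.1.2 p.2 p.2 := by
  unfold bilin
  fun_prop

/-- The lowest eigenvalue of the discrete form with weights `c`, `d`. -/
def lowest (Γ : MetricGraph V E) (w : (E → ℝ) × (E → ℝ)) : ℝ :=
  sInf ((fun f => bilin Γ w.1 w.2 f f) '' dirichletSphere Γ)

lemma continuous_lowest : Continuous (lowest Γ) :=
  isCompact_dirichletSphere.continuous_sInf continuous_bilin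

lemma bddBelow_bilin (w : (E → ℝ) × (E → ℝ)) :
    BddBelow ((fun f => bilin Γ w.1 w.2 f f) '' dirichletSphere Γ) :=
  isCompact_dirichletSphere.bddBelow_image
    (continuous_bilin.comp (continuous_const.prodMk continuous_id)).continuousOn

lemma exists_lowest (hne : (dirichletSphere Γ).Nonempty) (w : (E → ℝ) × (E → ℝ)) :
    ∃ f ∈ dirichletSphere Γ, bilin Γ w.1 w.2 f f = lowest Γ w := by
  obtain ⟨f, hf, h⟩ := isCompact_dirichletSphere.exists_sInf_image_eq (f := fun f =>
    bilin Γ w.1 w.2 f f) hne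
    (continuous_bilin.comp (continuous_const.prodMk continuous_id)).continuousOn
  exact ⟨f, hf, h.symm⟩

lemma lowest_le {w : (E → ℝ) × (E → ℝ)} {f : V → ℝ} (hf : f ∈ dirichletSphere Γ) :
    lowest Γ w ≤ bilin Γ w.1 w.2 f f :=
  csInf_le (bddBelow_bilin w) ⟨f, hf, rfl⟩

lemma bilin_nonneg_of_lowest {w : (E → ℝ) × (E → ℝ)} (hw : 0 ≤ lowest Γ w) {f : V → ℝ}
    (hf : f ∈ dirichletZero Γ) : 0 ≤ bilin Γ w.1 w.2 f f := by
  rcases eq_or_ne f 0 with rfl | hne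
  · simp [bilin]
  · obtain ⟨t, ht, htf⟩ := exists_smul_mem_dirichletSphere hf hne
    have := hw.trans (lowest_le htf)
    rw [bilin_smul] at this
    exact nonneg_of_mul_nonneg_right this (by positivity)

lemma lowest_neg {w : (E → ℝ) × (E → ℝ)} {f : V → ℝ}
    (hf : f ∈ dirichletZero Γ) (hneg : bilin Γ w.1 w.2 f f < 0) : lowest Γ w < 0 := by
  by_contra h
  exact absurd (bilin_nonneg_of_lowest (not_lt.1 h) hf) (not_le.2 hneg)

/-- The weights belonging to given phases. -/
def weights (θ : E → ℝ) : (E → ℝ) × (E → ℝ) := (cotWeight θ, cscWeight θ)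

omit [Fintype E] in
lemma continuousAt_weights {θ : E → ℝ} (h : ∀ e, Real.sin (θ e) ≠ 0) :
    ContinuousAt (weights (E := E)) θ := by
  refine ContinuousAt.prodMk (continuousAt_pi.2 fun e => ?_) (continuousAt_pi.2 fun e => ?_)
  · have h1 : Continuous fun θ : E → ℝ => Real.cos (θ e) := by fun_prop
    have h2 : Continuous fun θ : E → ℝ => Real.sin (θ e) := by fun_prop
    exact h1.continuousAt.div h2.continuousAt (h e)
  · have h2 : Continuous fun θ : E → ℝ => Real.sin (θ e) := by fun_prop
    exact continuousAt_const.div h2.continuousAt (h e)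

omit [Fintype E] in
lemma weights_sub_int_mul_two_pi (θ : E → ℝ) (m : E → ℤ) :
    weights (fun e => θ e - m e * (2 * Real.pi)) = weights θ := by
  simp only [weights, Prod.mk.injEq]
  constructor <;> funext e <;>
    simp [cotWeight, cscWeight, Real.sin_sub_int_mul_two_pi, Real.cos_sub_int_mul_two_pi]

/-- A discrete Poincaré inequality by compactness: a minimiser with value zero would be constant by
connectedness, and zero because of the Dirichlet vertex. -/
lemma exists_edge_form_bound (hconn : Γ.graph.Connected) (hD : Γ.dirichlet.Nonempty) :
    ∃ c > 0, ∀ f ∈ dirichletSphere Γ,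
      c ≤ ∑ e, (f (Γ.ends e false) - f (Γ.ends e true)) ^ 2 := by
  rcases (dirichletSphere Γ).eq_empty_or_nonempty with h | h
  · exact ⟨1, one_pos, fun f hf => by rw [h] at hf; exact absurd hf (notMem_empty f)⟩
  have hc : Continuous fun f : V → ℝ =>
    ∑ e, (f (Γ.ends e false) - f (Γ.ends e true)) ^ 2 := by fun_prop
  obtain ⟨f₀, hf₀, hmin⟩ := isCompact_dirichletSphere.exists_isMinOn h hc.continuousOn
  refine ⟨_, ?_, fun f hf => hmin hf⟩
  refine lt_of_le_of_ne (Finset.sum_nonneg fun _ _ => sq_nonneg _) fun h0 => ?_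
  rw [eq_comm, Finset.sum_eq_zero_iff_of_nonneg fun _ _ => sq_nonneg _] at h0
  have hedge (e : E) : f₀ (Γ.ends e false) = f₀ (Γ.ends e true) :=
    sub_eq_zero.1 (pow_eq_zero_iff two_ne_zero |>.1 (h0 e (Finset.mem_univ e)))
  obtain ⟨v₀, hv₀⟩ := hD
  have hz (v : V) : f₀ v = 0 := by
    refine forall_mem_of_connected hconn (W := {v | f₀ v = 0}) (fun e i he => ?_)
      (v₀ := v₀) (hf₀.1 v₀ hv₀) v
    cases i
    · exact (hedge e).symm.trans he
    · exact (hedge e).trans he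
  have := hf₀.2
  simp [hz] at this

omit [Fintype V] in
-- Splits the form into a gradient part, at least as large as the unweighted one when the sines are
-- positive, and a potential part whose coefficient `tan (θ / 2)` is small for small phases.
lemma bilin_weights (θ : E → ℝ) (f : V → ℝ) :
    bilin Γ (cotWeight θ) (cscWeight θ) f f =
      ∑ e, ((f (Γ.ends e false) - f (Γ.ends e true)) ^ 2 / Real.sin (θ e) -
        (1 - Real.cos (θ e)) / Real.sin (θ e) *
          (f (Γ.ends e false) ^ 2 + f (Γ.ends e true) ^ 2)) := by
  refine Finset.sum_congr rfl fun e _ => ?_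
  simp only [cotWeight, cscWeight]
  ring

/-- For small frequencies the form is positive when there is a Dirichlet vertex. -/
lemma eventually_lowest_pos (hconn : Γ.graph.Connected) (hD : Γ.dirichlet.Nonempty)
    (hne : (dirichletSphere Γ).Nonempty) :
    ∀ᶠ s in 𝓝[>] (0 : ℝ), 0 < lowest Γ (weights fun e => s * Γ.length e) := by
  obtain ⟨c, hc, hbound⟩ := exists_edge_form_bound hconn hD
  have h1 : ∀ᶠ s in 𝓝[>] (0 : ℝ), ∀ e, s * Γ.length e < 1 := by
    refine eventually_all.2 fun e => ?_
    have : Tendsto (fun s : ℝ => s * Γ.length e) (𝓝[>] 0) (𝓝 (0 * Γ.length e)) :=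
      (continuous_id.mul continuous_const).continuousAt.tendsto.mono_left nhdsWithin_le_nhds
    rw [zero_mul] at this
    exact this.eventually (gt_mem_nhds one_pos)
  have h2 : ∀ᶠ s in 𝓝[>] (0 : ℝ), ∑ e, s * Γ.length e * 2 < c := by
    have hcont : Continuous fun s : ℝ => ∑ e, s * Γ.length e * 2 := by fun_prop
    have := (hcont.tendsto 0).mono_left (nhdsWithin_le_nhds (s := Ioi (0 : ℝ)))
    simp only [zero_mul, Finset.sum_const_zero] at this
    exact this.eventually (gt_mem_nhds hc)
  filter_upwards [h1, h2, self_mem_nhdsWithin] with s hs1 hs2 hs0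
  obtain ⟨f, hf, hfl⟩ := exists_lowest hne (weights fun e => s * Γ.length e)
  rw [← hfl]
  change 0 < bilin Γ (cotWeight fun e => s * Γ.length e) (cscWeight fun e => s * Γ.length e) f f
  rw [bilin_weights, Finset.sum_sub_distrib, sub_pos]
  refine lt_of_le_of_lt ?_ (hs2.trans_le ((hbound f hf).trans ?_))
  · refine Finset.sum_le_sum fun e _ => ?_
    have hθ0 : 0 < s * Γ.length e := mul_pos hs0 (Γ.length_pos e)
    have hθ1 := hs1 e
    set θ := s * Γ.length e
    have hsin : θ / 2 < Real.sin θ := by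
      have := Real.sin_gt_sub_cube hθ0
      nlinarith [mul_pos hθ0 hθ0]
    have hcos := Real.one_sub_sq_div_two_le_cos (x := θ)
    have h3 : (1 - Real.cos θ) / Real.sin θ ≤ θ := by
      rw [div_le_iff₀ (by linarith)]
      nlinarith
    have h4 := sq_le_one_of_mem_dirichletSphere hf (Γ.ends e false)
    have h5 := sq_le_one_of_mem_dirichletSphere hf (Γ.ends e true)
    exact mul_le_mul h3 (by linarith) (by positivity) hθ0.le
  · refine Finset.sum_le_sum fun e _ => ?_
    have hθ0 : 0 < s * Γ.length e := mul_pos hs0 (Γ.length_pos e)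
    have hsin : 0 < Real.sin (s * Γ.length e) :=
      Real.sin_pos_of_pos_of_le_one hθ0 (hs1 e).le
    rw [le_div_iff₀ hsin]
    exact mul_le_of_le_one_right (sq_nonneg _) (Real.sin_le_one _)

lemma cos_div_sin_le {x : ℝ} (h0 : 0 < x) (h1 : x < Real.pi) :
    Real.cos x / Real.sin x ≤ 1 / x := by
  have hs := Real.sin_pos_of_pos_of_lt_pi h0 h1
  rcases le_or_gt (Real.pi / 2) x with h | h
  · have : Real.cos x ≤ 0 :=
      Real.cos_nonpos_of_pi_div_two_le_of_le h (by linarith [Real.pi_pos])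
    exact (div_nonpos_of_nonpos_of_nonneg this hs.le).trans (by positivity)
  · have hc : 0 < Real.cos x := Real.cos_pos_of_mem_Ioo ⟨by linarith, h⟩
    have := Real.lt_tan h0 h
    rw [Real.tan_eq_sin_div_cos, lt_div_iff₀ hc] at this
    rw [div_le_div_iff₀ hs h0]
    linarith

/-- Just below the first resonance of the longest edge the form takes negative values. -/
lemma exists_lowest_neg [Nonempty E]
    (hDD : ∀ e i, Γ.ends e i ∈ Γ.dirichlet → Γ.ends e (!i) ∉ Γ.dirichlet) :
    ∃ s > 0, (∀ e, s * Γ.length e < Real.pi) ∧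
      lowest Γ (weights fun e => s * Γ.length e) < 0 := by
  classical
  obtain ⟨e₀, he₀⟩ := Finite.exists_max Γ.length
  have hpi := Real.pi_pos
  set L := Γ.length e₀ with hL
  have hL0 : 0 < L := Γ.length_pos e₀
  -- An upper bound for `cot (s ℓ_e)`, from `cot x ≤ 1 / x` and `s L ≥ π / 2`.
  set B : E → ℝ := fun e => 2 * L / (Real.pi * Γ.length e) with hB
  have hB0 (e : E) : 0 < B e := by have := Γ.length_pos e; positivity
  set C := ∑ e, B e with hC
  have hC0 : 0 < C := Finset.sum_pos (fun e _ => hB0 e) Finset.univ_nonempty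
  -- Then `cot (sL) = cot (π - δ) = -C`: the longest edge outweighs all the others.
  set δ := Real.arctan (1 / C) with hδ
  have hδ0 : 0 < δ := Real.arctan_pos.2 (by positivity)
  have hδ1 : δ < Real.pi / 2 := Real.arctan_lt_pi_div_two _
  set s := (Real.pi - δ) / L with hs
  have hs0 : 0 < s := div_pos (by linarith) hL0
  have hsL : s * L = Real.pi - δ := by rw [hs]; field_simp
  have hlt (e : E) : s * Γ.length e < Real.pi := by
    have := mul_le_mul_of_nonneg_left (he₀ e) hs0.le
    linarith
  refine ⟨s, hs0, hlt, ?_⟩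
  set f : V → ℝ := fun v => if v ∈ Γ.dirichlet then 0 else 1 with hf
  have hfD : f ∈ dirichletZero Γ := fun v hv => if_pos hv
  refine lowest_neg hfD ?_
  change bilin Γ (cotWeight fun e => s * Γ.length e) (cscWeight fun e => s * Γ.length e) f f < 0
  -- An edge with one Dirichlet end contributes its cotangent; one with none contributes `2 cot - 2
  -- csc ≤ cot`.
  have hterm : bilin Γ (cotWeight fun e => s * Γ.length e) (cscWeight fun e => s * Γ.length e) f f ≤
      ∑ e, Real.cos (s * Γ.length e) / Real.sin (s * Γ.length e) := by
    refine Finset.sum_le_sum fun e _ => ?_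
    have hsin : 0 < Real.sin (s * Γ.length e) :=
      Real.sin_pos_of_pos_of_lt_pi (mul_pos hs0 (Γ.length_pos e)) (hlt e)
    have hdd := hDD e
    simp only [cotWeight, cscWeight, hf]
    by_cases h0 : Γ.ends e false ∈ Γ.dirichlet
    · have h1 := hdd false h0
      rw [Bool.not_false] at h1
      simp [h0, h1]
    · by_cases h1 : Γ.ends e true ∈ Γ.dirichlet
      · simp [h0, h1]
      · simp only [h0, h1, if_false]
        have hcos := Real.cos_le_one (s * Γ.length e)
        have : Real.cos (s * Γ.length e) / Real.sin (s * Γ.length e) ≤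
            2 * (1 / Real.sin (s * Γ.length e)) := by
          rw [mul_one_div]
          gcongr
          linarith
        linarith
  refine hterm.trans_lt ?_
  have hbound (e : E) : Real.cos (s * Γ.length e) / Real.sin (s * Γ.length e) ≤ B e := by
    have hℓ := Γ.length_pos e
    refine (cos_div_sin_le (mul_pos hs0 hℓ) (hlt e)).trans ?_
    rw [hB, div_le_div_iff₀ (by positivity) (by positivity)]
    have : Real.pi ≤ 2 * (L * s) := by linarith
    nlinarith
  have h0 : Real.cos (s * Γ.length e₀) / Real.sin (s * Γ.length e₀) = -C := by
    rw [← hL, hsL, Real.cos_pi_sub, Real.sin_pi_sub, neg_div, neg_inj]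
    have := Real.tan_arctan (1 / C)
    rw [← hδ, Real.tan_eq_sin_div_cos] at this
    rw [← inv_div, this]
    simp
  rw [← Finset.add_sum_erase _ _ (Finset.mem_univ e₀), h0]
  have h1 : ∑ e ∈ Finset.univ.erase e₀, Real.cos (s * Γ.length e) / Real.sin (s * Γ.length e) ≤
      ∑ e ∈ Finset.univ.erase e₀, B e := Finset.sum_le_sum fun e _ => hbound e
  have h2 : B e₀ + ∑ e ∈ Finset.univ.erase e₀, B e = C :=
    Finset.add_sum_erase _ _ (Finset.mem_univ e₀)
  linarith [hB0 e₀]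

/-- On a connected metric graph with a Dirichlet vertex, positive waves exist for arbitrarily
large frequencies. -/
theorem exists_hasPositiveWave_of_dirichlet [Nonempty E] (hconn : Γ.graph.Connected)
    (hD : Γ.dirichlet.Nonempty) (K : ℝ) : ∃ k > K, HasPositiveWave Γ k := by
  by_cases hint : ∃ e, Γ.ends e false ∈ Γ.dirichlet ∧ Γ.ends e true ∈ Γ.dirichlet
  · obtain ⟨e, h0, h1⟩ := hint
    exact exists_hasPositiveWave_of_interval hconn h0 h1 K
  have hDD : ∀ e i, Γ.ends e i ∈ Γ.dirichlet → Γ.ends e (!i) ∉ Γ.dirichlet := by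
    rintro e (_ | _) h h'
    · exact hint ⟨e, h, h'⟩
    · exact hint ⟨e, h', h⟩
  obtain ⟨s₁, hs₁, hπ, hneg⟩ := exists_lowest_neg hDD
  -- On an empty sphere `lowest` would be `sInf ∅ = 0`, which is not negative.
  have hne : (dirichletSphere Γ).Nonempty := by
    by_contra h
    rw [not_nonempty_iff_eq_empty] at h
    simp [lowest, h] at hneg
  obtain ⟨s₀, hpos, hs₀₁, hs₀⟩ : ∃ s, 0 < lowest Γ (weights fun e => s * Γ.length e) ∧
      s < s₁ ∧ 0 < s := by
    have h2 : ∀ᶠ s in 𝓝[>] (0 : ℝ), s < s₁ := nhdsWithin_le_nhds (gt_mem_nhds hs₁)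
    have h3 : ∀ᶠ s in 𝓝[>] (0 : ℝ), 0 < s := self_mem_nhdsWithin
    exact ((eventually_lowest_pos hconn hD hne).and (h2.and h3)).exists
  have hcont {θ : E → ℝ} (h : ∀ e, θ e ∈ Ioo 0 Real.pi) :
      ContinuousAt (fun θ => lowest Γ (weights θ)) θ :=
    continuous_lowest.continuousAt.comp (continuousAt_weights fun e =>
      (Real.sin_pos_of_pos_of_lt_pi (h e).1 (h e).2).ne')
  have hmem₀ (e : E) : s₀ * Γ.length e ∈ Ioo 0 Real.pi :=
    ⟨mul_pos hs₀ (Γ.length_pos e),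
      (mul_lt_mul_of_pos_right hs₀₁ (Γ.length_pos e)).trans (hπ e)⟩
  have hmem₁ (e : E) : s₁ * Γ.length e ∈ Ioo 0 Real.pi :=
    ⟨mul_pos hs₁ (Γ.length_pos e), hπ e⟩
  obtain ⟨ε₀, hε₀, hball₀⟩ := Metric.eventually_nhds_iff.1
    ((hcont hmem₀).eventually (lt_mem_nhds hpos))
  obtain ⟨ε₁, hε₁, hball₁⟩ := Metric.eventually_nhds_iff.1
    ((hcont hmem₁).eventually (gt_mem_nhds hneg))
  -- Phase errors below `ε` preserve both signs of `lowest` and keep all phases in `(0, π)` for `s`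
  -- between `s₀` and `s₁`.
  obtain ⟨ε, hε, hεe, hεle₀, hεle₁⟩ : ∃ ε : ℝ, 0 < ε ∧
      (∀ e, ε < s₀ * Γ.length e ∧ ε < Real.pi - s₁ * Γ.length e) ∧ ε < ε₀ ∧ ε < ε₁ := by
    have h0 : ∀ᶠ ε in 𝓝[>] (0 : ℝ), 0 < ε := self_mem_nhdsWithin
    have h1 : ∀ᶠ ε in 𝓝[>] (0 : ℝ), ∀ e, ε < s₀ * Γ.length e ∧ ε < Real.pi - s₁ * Γ.length e :=
      eventually_all.2 fun e => nhdsWithin_le_nhds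
        (Eventually.and (gt_mem_nhds (hmem₀ e).1) (gt_mem_nhds (sub_pos.2 (hmem₁ e).2)))
    have h2 : ∀ᶠ ε in 𝓝[>] (0 : ℝ), ε < ε₀ := nhdsWithin_le_nhds (gt_mem_nhds hε₀)
    have h3 : ∀ᶠ ε in 𝓝[>] (0 : ℝ), ε < ε₁ := nhdsWithin_le_nhds (gt_mem_nhds hε₁)
    exact (h0.and (h1.and (h2.and h3))).exists
  obtain ⟨k, hkK, m, hkm⟩ := exists_recurrence Γ.length hε K
  set η : E → ℝ := fun e => k * Γ.length e - m e * (2 * Real.pi) with hη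
  have hηε (e : E) : -ε < η e ∧ η e < ε := abs_lt.1 (hkm e)
  set path : ℝ → E → ℝ := fun s e => s * Γ.length e + η e with hpath
  have hpathmem {s : ℝ} (hs : s ∈ Icc s₀ s₁) (e : E) : path s e ∈ Ioo 0 Real.pi := by
    have h1 := mul_le_mul_of_nonneg_right hs.1 (Γ.length_pos e).le
    have h2 := mul_le_mul_of_nonneg_right hs.2 (Γ.length_pos e).le
    have h3 := hεe e
    have h4 := hηε e
    exact ⟨by simp only [hpath]; linarith, by simp only [hpath]; linarith⟩
  have hdist (s : ℝ) {ε' : ℝ} (h : ε < ε') : dist (path s) (fun e => s * Γ.length e) < ε' := by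
    rw [dist_pi_lt_iff (hε.trans h)]
    intro e
    rw [Real.dist_eq, hpath]
    simpa using (hkm e).trans h
  have hcp : Continuous path := by simp only [hpath]; fun_prop
  have hφ : ContinuousOn (fun s => lowest Γ (weights (path s))) (Icc s₀ s₁) := fun s hs =>
    ((hcont (hpathmem hs)).comp hcp.continuousAt).continuousWithinAt
  obtain ⟨s, hs, hs0⟩ := intermediate_value_Icc' hs₀₁.le hφ
    ⟨(hball₁ (hdist s₁ hεle₁)).le, (hball₀ (hdist s₀ hεle₀)).le⟩
  -- Modulo `2π` the perturbed phases are the true phases at frequency `k + s`.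
  have hpe : path s = fun e => (k + s) * Γ.length e - m e * (2 * Real.pi) := by
    funext e; simp only [hpath, hη]; ring
  have hw : weights (path s) = weights fun e => (k + s) * Γ.length e := by
    rw [hpe, weights_sub_int_mul_two_pi]
  simp only [hw] at hs0
  obtain ⟨f, hf, hfl⟩ := exists_lowest hne (weights fun e => (k + s) * Γ.length e)
  refine ⟨k + s, by linarith [hs.1], hasPositiveWave_of_kernel hconn hDD (fun e => ?_)
    (fun f hf => bilin_nonneg_of_lowest hs0.ge hf) hf.1 ?_ (hfl.trans hs0)⟩
  · have := hpathmem hs e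
    rw [← Real.sin_sub_int_mul_two_pi _ (m e), ← congrFun hpe e]
    exact Real.sin_pos_of_pos_of_lt_pi this.1 this.2
  · rintro rfl
    have := hf.2
    simp at this

end MetricGraph

/-! ### Trees without Dirichlet vertices: perturbing the constant function -/

namespace MetricGraph

open Filter Topology

variable {V E : Type*} {Γ : MetricGraph V E}

section HalfPhase

lemma cos_eq_of_tan_half {θ t : ℝ} (hc : Real.cos (θ / 2) ≠ 0) (ht : t = Real.tan (θ / 2)) :
    Real.cos θ = (1 - t ^ 2) / (1 + t ^ 2) := by
  have h := Real.sin_sq_add_cos_sq (θ / 2)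
  have h2 : Real.cos θ = 2 * Real.cos (θ / 2) ^ 2 - 1 := by
    rw [← Real.cos_two_mul]; congr 1; ring
  rw [ht, Real.tan_eq_sin_div_cos, eq_div_iff (by positivity), h2]
  field_simp
  linear_combination (2 * Real.cos (θ / 2) ^ 2) * h

lemma sin_eq_of_tan_half {θ t : ℝ} (hc : Real.cos (θ / 2) ≠ 0) (ht : t = Real.tan (θ / 2)) :
    Real.sin θ = 2 * t / (1 + t ^ 2) := by
  have h := Real.sin_sq_add_cos_sq (θ / 2)
  have h2 : Real.sin θ = 2 * Real.sin (θ / 2) * Real.cos (θ / 2) := by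
    rw [← Real.sin_two_mul]; congr 1; ring
  rw [ht, Real.tan_eq_sin_div_cos, eq_div_iff (by positivity), h2]
  field_simp
  linear_combination (Real.sin (θ / 2)) * h

end HalfPhase

/-- The orientation sign of an endpoint. -/
def endSign (i : Bool) : ℝ := if i then -1 else 1

section TreeOperator

variable [Fintype E]

open Classical in
/-- The sum of the inward fluxes at a vertex, when the flux into an edge is split into a part
proportional to the mean value on the edge and an antisymmetric part `q`. -/
def treeFlux (Γ : MetricGraph V E) (t : E → ℝ) (f : V → ℝ) (q : E → ℝ) (v : V) : ℝ :=
  ∑ p : E × Bool with Γ.ends p.1 p.2 = v,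
    (t p.1 * ((f (Γ.ends p.1 false) + f (Γ.ends p.1 true)) / 2) + endSign p.2 * q p.1)

lemma treeFlux_add (t : E → ℝ) (f f' : V → ℝ) (q q' : E → ℝ) (v : V) :
    treeFlux Γ t (f + f') (q + q') v = treeFlux Γ t f q v + treeFlux Γ t f' q' v := by
  simp only [treeFlux, ← Finset.sum_add_distrib]
  refine Finset.sum_congr rfl fun p _ => ?_
  simp only [Pi.add_apply]
  ring

lemma treeFlux_smul (t : E → ℝ) (c : ℝ) (f : V → ℝ) (q : E → ℝ) (v : V) :
    treeFlux Γ t (c • f) (c • q) v = c * treeFlux Γ t f q v := by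
  simp only [treeFlux, Finset.mul_sum]
  refine Finset.sum_congr rfl fun p _ => ?_
  simp only [Pi.smul_apply, smul_eq_mul]
  ring

variable [Fintype V]

/-- The antisymmetric part leaves one end of an edge and enters at the other, so it cancels in the
total. -/
lemma sum_treeFlux (t : E → ℝ) (f : V → ℝ) (q : E → ℝ) :
    ∑ v, treeFlux Γ t f q v = ∑ e, t e * (f (Γ.ends e false) + f (Γ.ends e true)) := by
  classical
  simp only [treeFlux]
  rw [sum_vertex_sum_endpoint (Γ := Γ) (fun _ p =>
    t p.1 * ((f (Γ.ends p.1 false) + f (Γ.ends p.1 true)) / 2) + endSign p.2 * q p.1)]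
  refine Finset.sum_congr rfl fun e _ => ?_
  simp only [endSign, if_true, Bool.false_eq_true, if_false]
  ring

lemma sum_mul_treeFlux_zero (f g : V → ℝ) (q : E → ℝ) :
    ∑ v, g v * treeFlux Γ 0 f q v = ∑ e, (g (Γ.ends e false) - g (Γ.ends e true)) * q e := by
  classical
  simp only [treeFlux, Finset.mul_sum]
  rw [sum_vertex_sum_endpoint (Γ := Γ) (fun v p => g v *
    ((0 : E → ℝ) p.1 * ((f (Γ.ends p.1 false) + f (Γ.ends p.1 true)) / 2) + endSign p.2 * q p.1))]
  refine Finset.sum_congr rfl fun e _ => ?_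
  simp only [endSign, if_true, Bool.false_eq_true, if_false, Pi.zero_apply]
  ring

open Classical in
/-- The operator of the secular system of a tree with root `r`, normalised at the root, for the half
phase tangents `t`. -/
def treeOp (Γ : MetricGraph V E) (r : V) (t : E → ℝ) :
    (V → ℝ) × (E → ℝ) →L[ℝ] (V → ℝ) × (E → ℝ) :=
  LinearMap.toContinuousLinearMap
    { toFun := fun x => (fun v => treeFlux Γ t x.1 x.2 v + if v = r then x.1 r else 0,
        fun e => x.1 (Γ.ends e true) - x.1 (Γ.ends e false) - 2 * t e * x.2 e)
      map_add' := by
        intro x y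
        ext v
        · simp only [Prod.fst_add, Prod.snd_add, treeFlux_add, Pi.add_apply]
          split_ifs <;> ring
        · simp only [Prod.fst_add, Prod.snd_add, Pi.add_apply]
          ring
      map_smul' := by
        intro c x
        ext v
        · simp only [Prod.smul_fst, Prod.smul_snd, treeFlux_smul, Pi.smul_apply, smul_eq_mul,
            RingHom.id_apply]
          split_ifs <;> ring
        · simp only [Prod.smul_fst, Prod.smul_snd, Pi.smul_apply, smul_eq_mul, RingHom.id_apply]
          ring }

open Classical in
lemma treeOp_fst (r : V) (t : E → ℝ) (x : (V → ℝ) × (E → ℝ)) (v : V) :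
    (treeOp Γ r t x).1 v = treeFlux Γ t x.1 x.2 v + if v = r then x.1 r else 0 := rfl

lemma treeOp_snd (r : V) (t : E → ℝ) (x : (V → ℝ) × (E → ℝ)) (e : E) :
    (treeOp Γ r t x).2 e = x.1 (Γ.ends e true) - x.1 (Γ.ends e false) - 2 * t e * x.2 e := rfl

/-- The dependence on `t` is affine, with no singularity at `t = 0`, in contrast to the cotangent
and cosecant weights. -/
lemma continuous_treeOp (r : V) : Continuous (treeOp Γ r) := by
  classical
  refine continuous_clm_apply.2 fun x => ?_
  refine Continuous.prodMk (continuous_pi fun v => ?_) (continuous_pi fun e => ?_)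
  · change Continuous fun t => treeFlux Γ t x.1 x.2 v + if v = r then x.1 r else 0
    unfold treeFlux
    fun_prop
  · change Continuous fun t : E → ℝ =>
      x.1 (Γ.ends e true) - x.1 (Γ.ends e false) - 2 * t e * x.2 e
    fun_prop

omit [Fintype E] [Fintype V] in
lemma eq_of_forall_edge (hconn : Γ.graph.Connected) {f : V → ℝ}
    (h : ∀ e, f (Γ.ends e true) = f (Γ.ends e false)) (r v : V) : f v = f r := by
  refine forall_mem_of_connected hconn (W := {v | f v = f r}) (fun e i he => ?_) (v₀ := r) rfl v
  cases i
  · exact (h e).trans he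
  · exact (h e).symm.trans he

lemma card_eq_of_isTree (hT : Γ.IsTree) : Fintype.card E + 1 = Fintype.card V := by
  classical
  rw [← hT.2.2.card_edgeFinset]
  congr 1
  rw [← Finset.card_univ, ← Finset.card_image_of_injective _ hT.2.1]
  congr 1
  ext z
  induction z with | _ v w
  rw [SimpleGraph.mem_edgeFinset, SimpleGraph.mem_edgeSet, graph, SimpleGraph.fromRel_adj]
  simp only [Finset.mem_image, Finset.mem_univ, true_and, Sym2.eq_iff]
  constructor
  · rintro ⟨e, ⟨rfl, rfl⟩ | ⟨rfl, rfl⟩⟩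
    · exact ⟨hT.1 e, Or.inl ⟨e, rfl, rfl⟩⟩
    · exact ⟨(hT.1 e).symm, Or.inr ⟨e, rfl, rfl⟩⟩
  · rintro ⟨-, ⟨e, rfl, rfl⟩ | ⟨e, rfl, rfl⟩⟩
    · exact ⟨e, Or.inl ⟨rfl, rfl⟩⟩
    · exact ⟨e, Or.inr ⟨rfl, rfl⟩⟩

/-- On a tree every function on the edges is a difference of a function on the vertices. -/
lemma exists_potential (hconn : Γ.graph.Connected) (hT : Γ.IsTree) (q : E → ℝ) :
    ∃ g : V → ℝ, ∀ e, g (Γ.ends e false) - g (Γ.ends e true) = q e := by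
  set D : (V → ℝ) →ₗ[ℝ] (E → ℝ) :=
    { toFun := fun g e => g (Γ.ends e false) - g (Γ.ends e true)
      map_add' := fun g g' => by ext e; simp only [Pi.add_apply]; ring
      map_smul' := fun c g => by
        ext e; simp only [Pi.smul_apply, smul_eq_mul, RingHom.id_apply]; ring } with hD
  obtain ⟨r⟩ := hconn.nonempty
  -- The kernel consists of constants, so the rank is at least `|V| - 1 = |E|`.
  have hker : Module.finrank ℝ (LinearMap.ker D) ≤ 1 := by
    have hle : LinearMap.ker D ≤ ℝ ∙ (fun _ => 1 : V → ℝ) := by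
      intro g hg
      rw [Submodule.mem_span_singleton]
      refine ⟨g r, ?_⟩
      funext v
      rw [Pi.smul_apply, smul_eq_mul, mul_one]
      refine (eq_of_forall_edge hconn (fun e => ?_) r v).symm
      exact (sub_eq_zero.1 (congrFun (LinearMap.mem_ker.1 hg) e)).symm
    exact (Submodule.finrank_mono hle).trans 
      (finrank_span_singleton (Function.ne_iff.2 ⟨r, one_ne_zero⟩)).le
  have hrn := LinearMap.finrank_range_add_finrank_ker D
  rw [Module.finrank_fintype_fun_eq_card, ← card_eq_of_isTree hT] at hrn
  have htop : LinearMap.range D = ⊤ := by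
    refine Submodule.eq_top_of_finrank_eq (le_antisymm (Submodule.finrank_le _) ?_)
    rw [Module.finrank_fintype_fun_eq_card]
    omega
  obtain ⟨g, hg⟩ := LinearMap.range_eq_top.1 htop q
  exact ⟨g, fun e => congrFun hg e⟩

/-- For a kernel element at `t = 0` the edge equations make `f` constant, and the sum of the vertex
equations gives `f r = 0`. Then `q` is a circulation; paired with its potential it gives `∑ q ^ 2 =
0`. -/
lemma isUnit_treeOp_zero (hconn : Γ.graph.Connected) (hT : Γ.IsTree) (r : V) :
    IsUnit (treeOp Γ r 0) := by
  classical
  have hinj : Function.Injective (treeOp Γ r 0) := by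
    refine (injective_iff_map_eq_zero _).2 fun x hx => ?_
    have hf (v : V) : x.1 v = x.1 r := by
      refine eq_of_forall_edge hconn (fun e => ?_) r v
      have := congrFun (congrArg Prod.snd hx) e
      rw [treeOp_snd] at this
      simpa [sub_eq_zero] using this
    have h1 (v : V) : treeFlux Γ 0 x.1 x.2 v + (if v = r then x.1 r else 0) = 0 :=
      congrFun (congrArg Prod.fst hx) v
    have hr : x.1 r = 0 := by
      have := Finset.sum_eq_zero fun v (_ : v ∈ Finset.univ) => h1 v
      rw [Finset.sum_add_distrib, sum_treeFlux] at this
      simpa using this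
    have hflux (v : V) : treeFlux Γ 0 x.1 x.2 v = 0 := by simpa [hr] using h1 v
    obtain ⟨g, hg⟩ := exists_potential hconn hT x.2
    have hq := sum_mul_treeFlux_zero (Γ := Γ) x.1 g x.2
    simp only [hflux, mul_zero, Finset.sum_const_zero, hg] at hq
    rw [eq_comm, Finset.sum_eq_zero_iff_of_nonneg fun _ _ => mul_self_nonneg _] at hq
    ext v
    · simp [hf v, hr]
    · simpa using hq v (Finset.mem_univ v)
  exact ContinuousLinearMap.isUnit_iff_bijective.2
    ⟨hinj, (LinearMap.injective_iff_surjective (f := (treeOp Γ r 0).toLinearMap)).1 hinj⟩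

open Classical in
/-- The normalised solution of the secular system of a tree, without the condition at the root. -/
def treeSol (Γ : MetricGraph V E) (r : V) (t : E → ℝ) : (V → ℝ) × (E → ℝ) :=
  Ring.inverse (treeOp Γ r t) (Pi.single r 1, 0)

open Classical in
lemma treeOp_treeSol {r : V} {t : E → ℝ} (h : IsUnit (treeOp Γ r t)) :
    treeOp Γ r t (treeSol Γ r t) = (Pi.single r 1, 0) :=
  DFunLike.congr_fun (Ring.mul_inverse_cancel _ h) _

lemma treeOp_injective {r : V} {t : E → ℝ} (h : IsUnit (treeOp Γ r t)) :
    Function.Injective (treeOp Γ r t) := (ContinuousLinearMap.isUnit_iff_bijective.1 h).1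

lemma continuousAt_treeSol {r : V} {t : E → ℝ} (h : IsUnit (treeOp Γ r t)) :
    ContinuousAt (treeSol Γ r) t := by
  classical
  have h1 : ContinuousAt (fun t => Ring.inverse (treeOp Γ r t)) t := by
    obtain ⟨u, hu⟩ := h
    refine ContinuousAt.comp (g := Ring.inverse) ?_ (continuous_treeOp r).continuousAt
    rw [← hu]
    exact NormedRing.inverse_continuousAt u
  exact h1.clm_apply continuousAt_const

/-- At `t = 0` the solution is `f = 1`, `q = 0`; invertibility and positivity are open conditions.
-/
lemma eventually_treeSol_pos (hconn : Γ.graph.Connected) (hT : Γ.IsTree) (r : V) :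
    ∀ᶠ t in 𝓝 (0 : E → ℝ), IsUnit (treeOp Γ r t) ∧ ∀ v, 0 < (treeSol Γ r t).1 v := by
  classical
  have h0 := isUnit_treeOp_zero hconn hT r
  refine ((continuous_treeOp r).continuousAt.eventually (Units.isOpen.mem_nhds h0)).and
    (eventually_all.2 fun v => ?_)
  have hsol : treeSol Γ r 0 = (fun _ => 1, 0) := by
    refine treeOp_injective h0 ?_
    rw [treeOp_treeSol h0]
    ext v
    · rw [treeOp_fst]
      simp [treeFlux, Pi.single_apply]
    · rw [treeOp_snd]
      simp
  have hc : ContinuousAt (fun t => (treeSol Γ r t).1 v) 0 :=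
    (continuous_apply v).continuousAt.comp
      (continuous_fst.continuousAt.comp (continuousAt_treeSol h0))
  refine hc.eventually (lt_mem_nhds ?_)
  simp only [hsol]
  exact one_pos

/-- The normalising term at the root cancels the right-hand side when the root value is `1`. -/
lemma treeFlux_treeSol {r : V} {t : E → ℝ} (h : IsUnit (treeOp Γ r t))
    (hr : (treeSol Γ r t).1 r = 1) (v : V) :
    treeFlux Γ t (treeSol Γ r t).1 (treeSol Γ r t).2 v = 0 := by
  classical
  have := congrFun (congrArg Prod.fst (treeOp_treeSol h)) v
  rw [treeOp_fst, hr] at this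
  simpa [Pi.single_apply] using this

lemma treeSol_edge {r : V} {t : E → ℝ} (h : IsUnit (treeOp Γ r t)) (e : E) :
    (treeSol Γ r t).1 (Γ.ends e true) - (treeSol Γ r t).1 (Γ.ends e false) =
      2 * t e * (treeSol Γ r t).2 e := by
  classical
  have := congrFun (congrArg Prod.snd (treeOp_treeSol h)) e
  rw [treeOp_snd] at this
  exact sub_eq_zero.1 this

/-- Summing all vertex equations eliminates `q`. For positive `f` and all `t e` of one sign, this
determines the sign of the defect at the root. -/
lemma one_sub_treeSol_root {r : V} {t : E → ℝ} (h : IsUnit (treeOp Γ r t)) :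
    1 - (treeSol Γ r t).1 r =
      ∑ e, t e * ((treeSol Γ r t).1 (Γ.ends e false) + (treeSol Γ r t).1 (Γ.ends e true)) := by
  classical
  rw [← sum_treeFlux (Γ := Γ) t (treeSol Γ r t).1 (treeSol Γ r t).2]
  have h1 (v : V) : treeFlux Γ t (treeSol Γ r t).1 (treeSol Γ r t).2 v =
      (Pi.single r 1 : V → ℝ) v - if v = r then (treeSol Γ r t).1 r else 0 := by
    have := congrFun (congrArg Prod.fst (treeOp_treeSol h)) v
    rw [treeOp_fst] at this
    exact eq_sub_of_add_eq this
  simp only [h1, Finset.sum_sub_distrib]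
  simp

theorem hasPositiveWave_of_treeSol {k : ℝ} (hD : ∀ v, v ∉ Γ.dirichlet) {t : E → ℝ}
    (hcos : ∀ e, Real.cos (k * Γ.length e / 2) ≠ 0)
    (ht : ∀ e, t e = Real.tan (k * Γ.length e / 2)) {r : V} (h : IsUnit (treeOp Γ r t))
    (hpos : ∀ v, 0 < (treeSol Γ r t).1 v) (hr : (treeSol Γ r t).1 r = 1) :
    HasPositiveWave Γ k := by
  classical
  set f := (treeSol Γ r t).1 with hf
  set q := (treeSol Γ r t).2 with hq
  have hC (e : E) := cos_eq_of_tan_half (hcos e) (ht e)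
  have hS (e : E) := sin_eq_of_tan_half (hcos e) (ht e)
  have hden (e : E) : 1 + t e ^ 2 ≠ 0 := by positivity
  have hedge (e : E) : f (Γ.ends e true) - f (Γ.ends e false) = 2 * t e * q e := treeSol_edge h e
  set a : E → ℝ := fun e => f (Γ.ends e false) with ha
  -- The inward slope at the left end: its symmetric part plus `q`.
  set b : E → ℝ := fun e => t e * ((f (Γ.ends e false) + f (Γ.ends e true)) / 2) + q e with hb
  have hval (e : E) (i : Bool) : endVal Γ k a b e i = f (Γ.ends e i) := by
    cases i
    · rfl
    · have := hden e
      simp only [endVal, wave, ha, hb, smul_eq_mul, hC, hS]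
      field_simp
      linear_combination -hedge e
  have hslope (e : E) (i : Bool) : endSlope Γ k a b e i =
      t e * ((f (Γ.ends e false) + f (Γ.ends e true)) / 2) + endSign i * q e := by
    cases i
    · simp [endSlope, hb, endSign]
    · have := hden e
      simp only [endSlope, wave, ha, hb, smul_eq_mul, hC, hS, endSign, if_true]
      field_simp
      linear_combination (-2 * t e) * hedge e
  refine ⟨a, b, ⟨fun v _ => ⟨fun e i e' i' h h' => ?_, ?_⟩, fun v hv => absurd hv (hD v)⟩,
    fun e i _ => ?_, fun e i hv => absurd hv (hD _), fun a' b' h' => ?_⟩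
  · rw [hval, hval, h, h']
  · rw [← treeFlux_treeSol h hr v, treeFlux]
    exact Finset.sum_congr rfl fun p _ => hslope p.1 p.2
  · rw [hval]; exact hpos _
  · choose ε ι hει using Γ.ends_surjective
    set g : V → ℝ := fun v => endVal Γ k a' b' (ε v) (ι v) with hg
    have hval' (e : E) (i : Bool) : endVal Γ k a' b' e i = g (Γ.ends e i) :=
      (h'.1 _ (hD _)).1 _ _ _ _ rfl (hει _)
    set q' : E → ℝ := fun e => (endSlope Γ k a' b' e false - endSlope Γ k a' b' e true) / 2 with hq'
    have hslope' (e : E) (i : Bool) : endSlope Γ k a' b' e i =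
        t e * ((g (Γ.ends e false) + g (Γ.ends e true)) / 2) + endSign i * q' e := by
      have := hden e
      rw [← hval', ← hval']
      cases i
      · simp only [hq', endSlope, endVal, wave, smul_eq_mul, hC, hS, endSign, Bool.false_eq_true,
          if_false]
        field_simp
        ring
      · simp only [hq', endSlope, endVal, wave, smul_eq_mul, hC, hS, endSign, if_true]
        field_simp
        ring
    -- Any secular solution solves the normalised system with right-hand side scaled by its root
    -- value, so injectivity gives uniqueness.
    have hop : treeOp Γ r t (g, q') = treeOp Γ r t (g r • treeSol Γ r t) := by
      rw [map_smul, treeOp_treeSol h]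
      ext v
      · rw [treeOp_fst]
        have : treeFlux Γ t g q' v = 0 := by
          rw [← (h'.1 v (hD v)).2, treeFlux]
          exact Finset.sum_congr rfl fun p _ => (hslope' p.1 p.2).symm
        rw [this]
        simp [Pi.single_apply]
      · rw [treeOp_snd]
        have := hden v
        simp only [Prod.smul_snd, smul_zero, Pi.zero_apply]
        rw [← hval', ← hval']
        simp only [hq', endSlope, endVal, wave, smul_eq_mul, hC, hS]
        field_simp
        ring
    have hx := treeOp_injective h hop
    have hgf (v : V) : g v = g r * f v := congrFun (congrArg Prod.fst hx) v
    have hqq (e : E) : q' e = g r * q e := congrFun (congrArg Prod.snd hx) e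
    refine ⟨g r, fun e => ⟨?_, ?_⟩⟩
    · exact (hval' e false).trans (hgf _)
    · refine (hslope' e false).trans ?_
      rw [hgf (Γ.ends e false), hgf (Γ.ends e true), hqq, hb]
      simp only [endSign, Bool.false_eq_true, if_false]
      ring

/-- On a tree without Dirichlet vertices, positive waves exist for arbitrarily large
frequencies. -/
theorem exists_hasPositiveWave_of_isTree [Nonempty E] (hconn : Γ.graph.Connected) (hT : Γ.IsTree)
    (hD : ∀ v, v ∉ Γ.dirichlet) (K : ℝ) : ∃ k > K, HasPositiveWave Γ k := by
  obtain ⟨r⟩ := hconn.nonempty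
  obtain ⟨ε, hε, hball⟩ := Metric.eventually_nhds_iff.1 (eventually_treeSol_pos hconn hT r)
  have htan : ContinuousAt Real.tan 0 := Real.continuousAt_tan.2 (by simp)
  obtain ⟨ρ₁, hρ₁, htanρ⟩ := Metric.continuousAt_iff.1 htan ε hε
  have hpi := Real.pi_pos
  set ρ := min ρ₁ (Real.pi / 2) with hρ
  have hρ0 : 0 < ρ := lt_min hρ₁ (by linarith)
  have htanε {x : ℝ} (hx : |x| < ρ) : |Real.tan x| < ε := by
    simpa using htanρ (x := x) (by simpa using hx.trans_le (min_le_left _ _))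
  have hcosx {x : ℝ} (hx : |x| < ρ) : x ∈ Ioo (-(Real.pi / 2)) (Real.pi / 2) :=
    abs_lt.1 (hx.trans_le (min_le_right _ _))
  obtain ⟨δ, hδ, hδℓ⟩ : ∃ δ : ℝ, 0 < δ ∧ ∀ e, δ * Γ.length e < ρ := by
    have h0 : ∀ᶠ δ in 𝓝[>] (0 : ℝ), 0 < δ := self_mem_nhdsWithin
    refine (h0.and (eventually_all.2 fun e => ?_)).exists
    have hc : Continuous fun δ : ℝ => δ * Γ.length e := by fun_prop
    have := (hc.tendsto 0).mono_left (nhdsWithin_le_nhds (s := Ioi (0 : ℝ)))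
    rw [zero_mul] at this
    exact this.eventually (gt_mem_nhds hρ0)
  -- With errors below `δ ℓ_e`, all half phases are negative at `s = -δ` and positive at `s = δ`.
  obtain ⟨ε', hε', hεe⟩ : ∃ ε' : ℝ, 0 < ε' ∧ ∀ e, ε' < δ * Γ.length e := by
    have h0 : ∀ᶠ ε' in 𝓝[>] (0 : ℝ), 0 < ε' := self_mem_nhdsWithin
    exact (h0.and (eventually_all.2 fun e =>
      nhdsWithin_le_nhds (gt_mem_nhds (mul_pos hδ (Γ.length_pos e))))).exists
  -- The margin `δ` keeps `k + s > K` for negative `s` as well.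
  obtain ⟨k, hkK, m, hkm⟩ := exists_recurrence Γ.length hε' (K + δ)
  set η : E → ℝ := fun e => k * Γ.length e - m e * (2 * Real.pi) with hη
  have hηε (e : E) : -ε' < η e ∧ η e < ε' := abs_lt.1 (hkm e)
  set half : ℝ → E → ℝ := fun s e => (s * Γ.length e + η e) / 2 with hhalf
  set path : ℝ → E → ℝ := fun s e => Real.tan (half s e) with hpath
  have hhalfρ {s : ℝ} (hs : s ∈ Icc (-δ) δ) (e : E) : |half s e| < ρ := by
    have h1 := mul_le_mul_of_nonneg_right hs.1 (Γ.length_pos e).le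
    have h2 := mul_le_mul_of_nonneg_right hs.2 (Γ.length_pos e).le
    have h3 := hεe e
    have h4 := hηε e
    have h5 := hδℓ e
    rw [abs_lt]
    constructor <;> simp only [hhalf] <;> linarith
  have hpathball {s : ℝ} (hs : s ∈ Icc (-δ) δ) : IsUnit (treeOp Γ r (path s)) ∧
      ∀ v, 0 < (treeSol Γ r (path s)).1 v := by
    refine hball ((dist_pi_lt_iff hε).2 fun e => ?_)
    rw [Pi.zero_apply, dist_zero_right]
    exact htanε (hhalfρ hs e)
  have hpathc {s : ℝ} (hs : s ∈ Icc (-δ) δ) : ContinuousAt path s := by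
    refine continuousAt_pi.2 fun e => ?_
    have hc : Continuous fun s => half s e := by simp only [hhalf]; fun_prop
    exact ContinuousAt.comp (g := Real.tan)
      (Real.continuousAt_tan.2 (Real.cos_pos_of_mem_Ioo (hcosx (hhalfρ hs e))).ne') hc.continuousAt
  have hφ : ContinuousOn (fun s => 1 - (treeSol Γ r (path s)).1 r) (Icc (-δ) δ) := fun s hs => by
    have h1 : ContinuousAt (fun s => treeSol Γ r (path s)) s :=
      ContinuousAt.comp (g := treeSol Γ r) (continuousAt_treeSol (hpathball hs).1) (hpathc hs)
    exact (continuousAt_const.sub ((continuous_apply r).continuousAt.comp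
      (continuous_fst.continuousAt.comp h1))).continuousWithinAt
  have hl : -δ ∈ Icc (-δ) δ := left_mem_Icc.2 (by linarith)
  have hu : δ ∈ Icc (-δ) δ := right_mem_Icc.2 (by linarith)
  have hsum (s : ℝ) (hs : s ∈ Icc (-δ) δ) (e : E) :
      0 < (treeSol Γ r (path s)).1 (Γ.ends e false) + (treeSol Γ r (path s)).1 (Γ.ends e true) :=
    add_pos ((hpathball hs).2 _) ((hpathball hs).2 _)
  have hneg : 1 - (treeSol Γ r (path (-δ))).1 r ≤ 0 := by
    rw [one_sub_treeSol_root (hpathball hl).1]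
    refine Finset.sum_nonpos fun e _ => mul_nonpos_of_nonpos_of_nonneg ?_ (hsum _ hl e).le
    have h1 := hcosx (hhalfρ hl e)
    refine Real.tan_nonpos_of_nonpos_of_neg_pi_div_two_le ?_ h1.1.le
    have h3 := hεe e
    have h4 := hηε e
    simp only [hhalf]
    linarith
  have hpos : 0 ≤ 1 - (treeSol Γ r (path δ)).1 r := by
    rw [one_sub_treeSol_root (hpathball hu).1]
    refine Finset.sum_nonneg fun e _ => mul_nonneg ?_ (hsum _ hu e).le
    have h1 := hcosx (hhalfρ hu e)
    refine Real.tan_nonneg_of_nonneg_of_le_pi_div_two ?_ h1.2.le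
    have h3 := hεe e
    have h4 := hηε e
    simp only [hhalf]
    linarith
  obtain ⟨s, hs, hs0⟩ := intermediate_value_Icc (by linarith) hφ ⟨hneg, hpos⟩
  -- Half phases are determined modulo `π`, which is a period of the tangent.
  have hhe (e : E) : half s e = (k + s) * Γ.length e / 2 - m e * Real.pi := by
    simp only [hhalf, hη]; ring
  refine ⟨k + s, by linarith [hs.1], hasPositiveWave_of_treeSol hD (t := path s) (fun e h0 => ?_)
    (fun e => ?_) (hpathball hs).1 (hpathball hs).2 (sub_eq_zero.1 hs0).symm⟩
  · refine (Real.cos_pos_of_mem_Ioo (hcosx (hhalfρ hs e))).ne' ?_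
    rw [hhe, Real.cos_sub_int_mul_pi, h0, mul_zero]
  · simp only [hpath]
    rw [hhe, Real.tan_sub_int_mul_pi]

end TreeOperator

end MetricGraph

end

/-! ### Conclusion -/

theorem mainTheorem2 {V E : Type*} [Fintype V] [Fintype E] (Γ : MetricGraph V E)
    (hconn : Γ.graph.Connected) (h : Γ.IsTree ∨ Γ.dirichlet.Nonempty) :
    (Even Γ.eulerChar → ∃ μ : ℕ → ℝ, StrictMono μ ∧ ∀ j, Γ.IsSimpleEigenvalue (μ j) ∧
      ∀ ψ ∈ Γ.eigenspace (μ j), ψ ≠ 0 →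
        Finite (MetricGraph.NodalDomain ψ.1) ∧ Even (Nat.card (MetricGraph.NodalDomain ψ.1))) ∧
    (Odd Γ.eulerChar → ∃ μ : ℕ → ℝ, StrictMono μ ∧ ∀ j, Γ.IsSimpleEigenvalue (μ j) ∧
      ∀ ψ ∈ Γ.eigenspace (μ j), ψ ≠ 0 →
        Finite (MetricGraph.NodalDomain ψ.1) ∧ Odd (Nat.card (MetricGraph.NodalDomain ψ.1))) := by
  have hE : Nonempty E := by
    obtain ⟨v⟩ := hconn.nonempty
    obtain ⟨e, -⟩ := Γ.ends_surjective v
    exact ⟨e⟩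
  have hwave (K : ℝ) : ∃ k > K, Γ.HasPositiveWave k := by
    -- Trees with Dirichlet vertices belong to the first case.
    by_cases hD : Γ.dirichlet.Nonempty
    · exact MetricGraph.exists_hasPositiveWave_of_dirichlet hconn hD K
    · exact MetricGraph.exists_hasPositiveWave_of_isTree hconn (h.resolve_right hD)
        (fun v hv => hD ⟨v, hv⟩) K
  obtain ⟨μ, hμ, H⟩ := MetricGraph.exists_strictMono_of_hasPositiveWave hwave
  constructor
  · refine fun hχ => ⟨μ, hμ, fun j => ⟨(H j).1, fun ψ hψ hne => ?_⟩⟩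
    obtain ⟨hfin, hcard⟩ := (H j).2 ψ hψ hne
    exact ⟨hfin, (Int.even_coe_nat _).1 ((Int.even_sub.1 hcard).2 hχ)⟩
  · refine fun hχ => ⟨μ, hμ, fun j => ⟨(H j).1, fun ψ hψ hne => ?_⟩⟩
    obtain ⟨hfin, hcard⟩ := (H j).2 ψ hψ hne
    exact ⟨hfin, Int.odd_coe_nat _ |>.1 ((Int.even_sub'.1 hcard).2 hχ)⟩
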